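/- **Theorem (Quasi-orthogonality).** Let $d\ge 2$ and let $\Omega\subset\mathbb{R}^d$ be a nonempty bounded Lipschitz domain with boundary $\Gamma$, surface measure $dA$ and outward unit normal $\mathbf n$. Let $\Gamma_D\subseteq\Gamma$ be compact and let $\gamma$ be a real function, bounded on $\Gamma\setminus\Gamma_D$. Let $(\phi_i)$ be a family of real functions, orthonormal in $L^2(\Omega)$, and $(E_i)$ real numbers, such that $\phi_i\in C^2(\Omega)$, $$-\Delta\phi_i=E_i\phi_i\ \text{ in }\Omega,\qquad \phi_i=0\ \text{ a.e. on }\Gamma_D,\qquad \gamma\phi_i+\partial_n\phi_i=0\ \text{ a.e. on }\Gamma\setminus\Gamma_D ,$$ and such that $\phi_i$ and $\nabla\phi_i$ are defined up to the boundary in the following sense: they have nontangential limits at almost every point of $\Gamma$ (which are their boundary values) and their nontangential maximal functions belong to $L^2(\Gamma)$. (This holds, for instance, if $\phi_i\in C^2(\Omega)\cap C^1(\overline\Omega)$.) For an origin $\mathbf a\in\mathbb{R}^d$ and $\mathcal E\in\mathbb{R}$ put, with $\mathbf r=\mathbf s-\mathbf a$ for $\mathbf s\in\Gamma$, $r_n=\mathbf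 r\cdot\mathbf n$, $u_n=\mathbf n\cdot\nabla u$, $u_r=\mathbf r\cdot\nabla u$, $$q_{\mathbf a}(u,v;\mathcal E)=\oint_\Gamma \Big[\tfrac{d-2}{2}(u_nv+v_nu)+r_n\big(\tfrac{\mathcal E}{2}uv-\nabla u\cdot\nabla v\big)+u_rv_n+v_ru_n\Big]\,dA,\qquad Q^{\mathbf a}_{ij}=q_{\mathbf a}(\phi_i,\phi_j;E_i+E_j),$$ and $R_{\mathbf a}=\max_{\mathbf s\in\Gamma}|\mathbf s-\mathbf a|$. Then, for every origin $\mathbf a$, the integrals defining $Q^{\mathbf a}_{ij}$ converge absolutely, $$Q^{\mathbf a}_{ii}=2E_i\quad\text{for all } i,\qquad |Q^{\mathbf a}_{ij}|\le \frac{R_{\mathbf a}^2}{4}\,(E_i-E_j)^2\quad\text{for all } i\ne j .$$ Moreover there is a smallest closed ball containing $\Omega$; its centre $\mathbf a_0$ is unique and, $R_0$ being its radius, $R_{\mathbf a_0}=R_0$ and $R_{\mathbf a}^2/4>R_0^2/4$ for every $\mathbf a\ne\mathbf a_0$. Thus $\mathbf a_0$ is the unique origin for which the constant $R_{\mathbf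 a}^2/4$ is smallest, and there $$|Q^{\mathbf a_0}_{ij}|\le \frac{R_0^2}{4}\,(E_i-E_j)^2\quad\text{for all } i\ne j .$$ -/

import Mathlib

open MeasureTheory Filter Topology Set

noncomputable section

namespace QuasiOrth

/-- The Euclidean space `ℝᵈ`. -/
abbrev Space (d : ℕ) := EuclideanSpace ℝ (Fin d)

variable {d : ℕ}

/-- A bounded Lipschitz domain: a bounded open set which near each of its boundary points is the
strict epigraph, in some direction `e`, of a Lipschitz function of the coordinates orthogonal to
`e`. (Such a function is represented by a function `g` on the whole space which is constant along
the lines parallel to `e`. A Lipschitz function of the orthogonal coordinates given on a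
neighbourhood only extends to a global one, so that `g` may be taken to be global.) -/
structure IsLipschitzDomain (Ω : Set (Space d)) : Prop where
  isOpen : IsOpen Ω
  isBounded : Bornology.IsBounded Ω
  graph : ∀ p ∈ frontier Ω, ∃ e : Space d, ‖e‖ = 1 ∧ ∃ (K : NNReal) (g : Space d → ℝ),
    LipschitzWith K g ∧ (∀ (x : Space d) (t : ℝ), g (x + t • e) = g x) ∧
      ∃ r > 0, Ω ∩ Metric.ball p r = {x | g x < inner ℝ e x} ∩ Metric.ball p r

/-- The surface measure `dA` on `∂Ω`: the `(d-1)`-dimensional Hausdorff measure, normalised to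
agree with Lebesgue measure on hyperplanes, restricted to `∂Ω`. -/
def surfaceMeasure (Ω : Set (Space d)) : Measure (Space d) :=
  (μHE[d - 1]).restrict (frontier Ω)

/-- `n` is the outward unit normal vector of `Ω` at `s`: up to first order at `s`, the set `Ω`
is the half-space `⟪n, x - s⟫ < 0`. (There is at most one such `n`.) -/
def IsOutwardNormal (Ω : Set (Space d)) (s n : Space d) : Prop :=
  ‖n‖ = 1 ∧ ∀ ε > 0, ∀ᶠ x in 𝓝 s,
    (x ∈ Ω → inner ℝ n (x - s) ≤ ε * ‖x - s‖) ∧ (x ∉ Ω → -(ε * ‖x - s‖) ≤ inner ℝ n (x - s))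

open Classical in
/-- The outward unit normal vector of `Ω` at `s` (`0` at points that have none; on the boundary of
a Lipschitz domain these form a set of surface measure zero). -/
def normal (Ω : Set (Space d)) (s : Space d) : Space d :=
  if h : ∃ n, IsOutwardNormal Ω s n then h.choose else 0

/-- The nontangential approach region of aperture `κ > 1` at the boundary point `s`. -/
def approachRegion (Ω : Set (Space d)) (κ : ℝ) (s : Space d) : Set (Space d) :=
  {x | x ∈ Ω ∧ ‖x - s‖ < κ * Metric.infDist x (frontier Ω)}

variable {V : Type*} [NormedAddCommGroup V]

/-- `F`, a function on `Ω`, has the nontangential limit `L` at the boundary point `s`. -/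
def HasBoundaryValue (Ω : Set (Space d)) (F : Space d → V) (s : Space d) (L : V) : Prop :=
  ∀ κ > 1, Tendsto F (𝓝[approachRegion Ω κ s] s) (𝓝 L)

open Classical in
/-- The value at the boundary point `s` of a function `F` on `Ω` (`0` if there is none). It
depends only on the values of `F` inside `Ω`. If `F` on `Ω` extends continuously to the closure
of `Ω` and `Ω` is Lipschitz, it is the value of that extension. -/
def boundaryValue (Ω : Set (Space d)) (F : Space d → V) (s : Space d) : V :=
  if h : ∃ L, HasBoundaryValue Ω F s L then h.choose else 0

/-- The nontangential maximal function of `F`. -/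
def maximalFunction (Ω : Set (Space d)) (κ : ℝ) (F : Space d → V) (s : Space d) : ENNReal :=
  ⨆ x ∈ approachRegion Ω κ s, ‖F x‖ₑ

/-- `F` is defined up to the boundary: it has nontangential boundary values at almost every
boundary point, and its nontangential maximal functions are square integrable over `∂Ω`. Every
continuous function on the closure of a bounded Lipschitz domain has this property. -/
structure RegularUpToBoundary (Ω : Set (Space d)) (F : Space d → V) : Prop where
  exists_boundaryValue : ∀ᵐ s ∂(surfaceMeasure Ω), ∃ L, HasBoundaryValue Ω F s L
  maximalFunction_sq : ∀ κ > 1, ∫⁻ s, maximalFunction Ω κ F s ^ 2 ∂(surfaceMeasure Ω) < ⊤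

/-- The values of `u` on the boundary of `Ω`. -/
def trace (Ω : Set (Space d)) (u : Space d → ℝ) (s : Space d) : ℝ :=
  boundaryValue Ω u s

/-- The values of `∇u` on the boundary of `Ω`. -/
def gradTrace (Ω : Set (Space d)) (u : Space d → ℝ) (s : Space d) : Space d :=
  boundaryValue Ω (gradient u) s

/-- The normal derivative `u_n = n · ∇u` on the boundary of `Ω`. -/
def normalDeriv (Ω : Set (Space d)) (u : Space d → ℝ) (s : Space d) : ℝ :=
  inner ℝ (normal Ω s) (gradTrace Ω u s)

/-- The derivative `u_r = r · ∇u` on the boundary of `Ω`, where `r = s - a` is the position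
relative to the origin `a`. -/
def radialDeriv (Ω : Set (Space d)) (a : Space d) (u : Space d → ℝ) (s : Space d) : ℝ :=
  inner ℝ (s - a) (gradTrace Ω u s)

/-- The integrand of the boundary form `q(u, v; ℰ)` with the coordinate origin placed at `a`:
`(d-2)/2 (u_n v + v_n u) + r_n (ℰ/2 u v - ∇u·∇v) + u_r v_n + v_r u_n`. -/
def qIntegrand (Ω : Set (Space d)) (a : Space d) (u v : Space d → ℝ) (ℰ : ℝ) (s : Space d) : ℝ :=
  ((d : ℝ) - 2) / 2 * (normalDeriv Ω u s * trace Ω v s + normalDeriv Ω v s * trace Ω u s)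
    + inner ℝ (s - a) (normal Ω s) *
      (ℰ / 2 * (trace Ω u s * trace Ω v s) - inner ℝ (gradTrace Ω u s) (gradTrace Ω v s))
    + radialDeriv Ω a u s * normalDeriv Ω v s + radialDeriv Ω a v s * normalDeriv Ω u s

/-- The boundary form `q(u, v; ℰ)` with the coordinate origin placed at `a`. -/
def q (Ω : Set (Space d)) (a : Space d) (u v : Space d → ℝ) (ℰ : ℝ) : ℝ :=
  ∫ s, qIntegrand Ω a u v ℰ s ∂(surfaceMeasure Ω)

/-- `φ` is a solution of `-Δφ = E φ` in `Ω` which is, with its first derivatives, defined up to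
the boundary, with `φ = 0` on `ΓD` and `γ φ + ∂ₙφ = 0` on `∂Ω \ ΓD`. -/
structure IsEigenfunction (Ω ΓD : Set (Space d)) (γ : Space d → ℝ) (E : ℝ) (φ : Space d → ℝ) :
    Prop where
  contDiffOn : ContDiffOn ℝ 2 φ Ω
  helmholtz : ∀ x ∈ Ω, -(Laplacian.laplacian φ x) = E * φ x
  regular : RegularUpToBoundary Ω φ
  regular_gradient : RegularUpToBoundary Ω (gradient φ)
  dirichlet : ∀ᵐ s ∂(surfaceMeasure Ω), s ∈ ΓD → trace Ω φ s = 0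
  robin : ∀ᵐ s ∂(surfaceMeasure Ω), s ∉ ΓD → γ s * trace Ω φ s + normalDeriv Ω φ s = 0

/-- The matrix element `Q_ij = q(φ_i, φ_j; E_i + E_j)`, with the coordinate origin placed
at `a`. -/
def Q (Ω : Set (Space d)) (a : Space d) {ι : Type*} (φ : ι → Space d → ℝ) (E : ι → ℝ)
    (i j : ι) : ℝ :=
  q Ω a (φ i) (φ j) (E i + E j)

/-- The maximum distance `R` of a point of `∂Ω` from the origin `a`. -/
def maxRadius (Ω : Set (Space d)) (a : Space d) : ℝ :=
  sSup ((fun s => ‖s - a‖) '' frontier Ω)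

end QuasiOrth

end

set_option linter.unusedSectionVars false

namespace QuasiOrth

open Module

/-! ### Area formula for distance-expanding Lipschitz maps. -/

section AreaFormula

/-! The theorem rests on an identity that evaluates `Q` by interior integrals. Write r = x - a, and
let u, v be eigenfunctions with eigenvalues E, E'. The boundary integrand is the normal component of
a Rellich–Pohozaev field (`rellichField`). Its divergence is (E + E') u v + (E - E')/2 · r·(v∇u -
u∇v): the Hessian terms cancel by symmetry, and the ∇u·∇v terms cancel because 2((d-2)/2 + 1) = d.

The first-order remainder is removed by a second field, |r|²/2 (v∇u - u∇v) (`momentField`). Its flux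
vanishes because u and v satisfy the same boundary condition, and its divergence gives ∫ r·(v∇u -
u∇v) = (E - E')/2 ∫ |r|² u v. Hence (`q_eq`) q(u, v; E + E') = (E + E') ∫ u v + (E - E')²/4 ∫ |r|² u
v. The second power of E - E' arises because each field contributes one factor. Orthonormality then
gives the diagonal values, and |r| ≤ R together with |u v| ≤ (u² + v²)/2 gives the off-diagonal
bound. The optimal origin is the centre of the smallest enclosing ball, unique by the parallelogram
law.

Most of the work is the divergence theorem on a bounded Lipschitz domain for C¹ fields that have
a.e. nontangential limits, integrable nontangential maximal functions and integrable divergence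
(`IsLipschitzDomain.integral_divergence`). A partition of unity localizes it to epigraphs of
Lipschitz functions. There it holds for smooth fields by Fubini, the fundamental theorem of calculus
along vertical lines and integration by parts along the graph. A rough field is treated on the graph
shifted upwards by t, where it is regular, and t → 0 by dominated convergence with the maximal
function as majorant. The area formula identifies the Hausdorff measure on the graph with the length
of the unnormalized normal times Lebesgue measure. -/

lemma _root_.LipschitzOnWith.euclideanHausdorffMeasure_image_le {X Y : Type*} [MetricSpace X]
    [MeasurableSpace X] [BorelSpace X] [MetricSpace Y] [MeasurableSpace Y] [BorelSpace Y]
    {f : X → Y} {s : Set X} {c : NNReal} (h : LipschitzOnWith c f s) (n : ℕ) :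
    μHE[n] (f '' s) ≤ (c : ENNReal) ^ n * μHE[n] s := by
  have := h.hausdorffMeasure_image_le (d := n) (by positivity)
  simp only [Measure.euclideanHausdorffMeasure_def, Measure.smul_apply, ENNReal.smul_def,
    smul_eq_mul]
  rw [mul_left_comm]
  gcongr
  simpa using this

/-- The hypothesis makes `f` factor through `g` on `t`, by a map that is `c`-Lipschitz on `g '' t`;
neither map needs to be injective. -/
lemma euclideanHausdorffMeasure_image_le_of_dist_le {X Y Z : Type*} [MetricSpace Y]
    [MeasurableSpace Y] [BorelSpace Y] [MetricSpace Z] [MeasurableSpace Z] [BorelSpace Z]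
    {f : X → Y} {g : X → Z} {t : Set X} {c : NNReal}
    (h : ∀ x ∈ t, ∀ y ∈ t, dist (f x) (f y) ≤ c * dist (g x) (g y)) (n : ℕ) :
    μHE[n] (f '' t) ≤ (c : ENNReal) ^ n * μHE[n] (g '' t) := by
  rcases t.eq_empty_or_nonempty with rfl | ⟨x₀, hx₀⟩
  · simp
  have : Nonempty X := ⟨x₀⟩
  have hinv : ∀ z ∈ g '' t, Function.invFunOn g t z ∈ t ∧ g (Function.invFunOn g t z) = z :=
    fun z hz => ⟨Function.invFunOn_mem hz, Function.invFunOn_eq hz⟩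
  have himg : f '' t = (f ∘ Function.invFunOn g t) '' (g '' t) := by
    rw [image_image]
    refine image_congr fun x hx => ?_
    have h1 := hinv (g x) (mem_image_of_mem g hx)
    have h2 := h x hx _ h1.1
    rw [h1.2, dist_self, mul_zero] at h2
    exact dist_le_zero.1 h2
  rw [himg]
  refine LipschitzOnWith.euclideanHausdorffMeasure_image_le
    (LipschitzOnWith.of_dist_le_mul fun z hz w hw => ?_) n
  have h1 := hinv z hz
  have h2 := hinv w hw
  simpa [h1.2, h2.2] using h _ h1.1 _ h2.1

/-- Once the cover is made disjoint, every measurable set splits into countably many parts, each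
inside a single piece. -/
lemma _root_.MeasureTheory.Measure.le_of_countable_cover {α ι : Type*} [MeasurableSpace α]
    [Countable ι] {μ ν : Measure α} (p : ι → Set α) (hp : ∀ i, MeasurableSet (p i))
    (hcov : μ (⋃ i, p i)ᶜ = 0)
    (h : ∀ i, ∀ u ⊆ p i, MeasurableSet u → μ u ≤ ν u) : μ ≤ ν := by
  rcases isEmpty_or_nonempty ι with hι | hι
  · have : μ = 0 := by simpa using hcov
    rw [this]; exact Measure.zero_le ν
  obtain ⟨k, hk⟩ := exists_surjective_nat ι
  set q := disjointed (p ∘ k) with hq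
  have hqm : ∀ n, MeasurableSet (q n) := fun n =>
    MeasurableSet.disjointed (fun i => hp (k i)) n
  have hqu : ⋃ n, q n = ⋃ i, p i := by
    rw [hq, iUnion_disjointed]
    exact hk.iUnion_comp p
  refine Measure.le_iff.2 fun s hs => ?_
  have hd : Pairwise (Function.onFun Disjoint fun n => s ∩ q n) := fun i j hij =>
    ((disjoint_disjointed (p ∘ k)) hij).mono inter_subset_right inter_subset_right
  calc μ s ≤ μ (s ∩ ⋃ n, q n) + μ (⋃ n, q n)ᶜ := by
        refine (measure_mono fun x hx => ?_).trans (measure_union_le _ _)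
        by_cases h : x ∈ ⋃ n, q n
        · exact Or.inl ⟨hx, h⟩
        · exact Or.inr h
    _ = ∑' n, μ (s ∩ q n) := by
        rw [hqu, hcov, add_zero, ← hqu, inter_iUnion, measure_iUnion hd fun n => hs.inter (hqm n)]
    _ ≤ ∑' n, ν (s ∩ q n) := by
        refine ENNReal.tsum_le_tsum fun n => h (k n) _ ?_ (hs.inter (hqm n))
        exact inter_subset_right.trans (disjointed_subset _ _)
    _ = ν (⋃ n, s ∩ q n) := (measure_iUnion hd fun n => hs.inter (hqm n)).symm
    _ ≤ ν s := measure_mono (iUnion_subset fun n => inter_subset_left)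

variable {H E : Type*} [NormedAddCommGroup H] [InnerProductSpace ℝ H] [FiniteDimensional ℝ H]
  [MeasurableSpace H] [BorelSpace H] [NormedAddCommGroup E] [InnerProductSpace ℝ E]
  [FiniteDimensional ℝ E] [MeasurableSpace E] [BorelSpace E]

/-- No determinant is computed: both numbers are read off from the Hausdorff measures of the images
of the unit ball, which the distance comparison orders. -/
lemma normDet_le_of_norm_le {A B : H →L[ℝ] E} {c : NNReal} (h : ∀ v, ‖B v‖ ≤ c * ‖A v‖) :
    ENNReal.ofReal B.toLinearMap.normDet ≤
      (c : ENNReal) ^ finrank ℝ H * ENNReal.ofReal A.toLinearMap.normDet := by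
  have h1 := euclideanHausdorffMeasure_image_le_of_dist_le (f := B.toLinearMap)
    (g := A.toLinearMap) (t := Metric.ball (0 : H) 1) (c := c)
    (fun x _ y _ => by simpa [dist_eq_norm, ← map_sub] using h (x - y)) (finrank ℝ H)
  rw [LinearMap.euclideanHausdorffMeasure_image_eq_normDet_mul_volume,
    LinearMap.euclideanHausdorffMeasure_image_eq_normDet_mul_volume, ← mul_assoc] at h1
  refine (ENNReal.mul_le_mul_iff_left ?_ ?_).1 h1
  · exact (Metric.measure_ball_pos volume _ one_pos).ne'
  · exact measure_ball_lt_top.ne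

/-- Pieces on which a map is, together with its derivative, nearly linear. -/
lemma exists_nearly_linear_cover {f : H → E} {δ : NNReal} (hδ : δ ≠ 0) :
    ∃ (p : ℕ × ℕ → Set H) (A : ℕ × ℕ → H →L[ℝ] E), (∀ i, MeasurableSet (p i)) ∧
      {x | DifferentiableAt ℝ f x} ⊆ ⋃ i, p i ∧
      ∀ i, (p i).Nonempty → (∃ y, DifferentiableAt ℝ f y ∧ A i = fderiv ℝ f y) ∧
        (∀ x ∈ p i, DifferentiableAt ℝ f x ∧ ‖fderiv ℝ f x - A i‖ ≤ 2 * δ) ∧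
        ApproximatesLinearOn f (A i) (p i) δ := by
  have hδ' : (0 : ℝ) < δ := by exact_mod_cast pos_iff_ne_zero.2 hδ
  -- The partition lemma controls the increments of `f` but not its derivative. Restricting first to
  -- sets where the derivative stays within `δ` of a fixed map bounds its oscillation there by `2 *
  -- δ`.
  let D : ℕ → Set H := fun k =>
    {x | DifferentiableAt ℝ f x} ∩ (fderiv ℝ f) ⁻¹' Metric.ball (TopologicalSpace.denseSeq _ k) δ
  have hD : ∀ k, MeasurableSet (D k) := fun k =>
    (measurableSet_of_differentiableAt ℝ f).inter (measurable_fderiv ℝ f Metric.isOpen_ball.measurableSet)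
  have key := fun k => exists_partition_approximatesLinearOn_of_hasFDerivWithinAt f (D k)
    (fderiv ℝ f) (fun x hx => hx.1.hasFDerivAt.hasFDerivWithinAt) (fun _ => δ) (fun _ => hδ)
  choose t A ht1 ht2 ht3 ht4 ht5 using key
  refine ⟨fun i => D i.1 ∩ t i.1 i.2, fun i => A i.1 i.2, fun i => (hD _).inter (ht2 _ _), ?_, ?_⟩
  · intro x hx
    obtain ⟨k, hk⟩ := (TopologicalSpace.denseRange_denseSeq (H →L[ℝ] E)).exists_dist_lt
      (fderiv ℝ f x) hδ'
    have hxk : x ∈ D k := ⟨hx, hk⟩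
    obtain ⟨m, hm⟩ := mem_iUnion.1 (ht3 k hxk)
    exact mem_iUnion.2 ⟨(k, m), hxk, hm⟩
  · rintro ⟨k, m⟩ ⟨z, hz⟩
    obtain ⟨y, hy, hAy⟩ := ht5 k ⟨z, hz.1⟩ m
    refine ⟨⟨y, hy.1, hAy⟩, fun x hx => ⟨hx.1.1, ?_⟩, ht4 k m⟩
    have h1 := hx.1.2
    have h2 := hy.2
    simp only [mem_preimage, Metric.mem_ball] at h1 h2
    change ‖fderiv ℝ f x - A k m‖ ≤ 2 * δ
    rw [hAy, ← dist_eq_norm]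
    linarith [dist_triangle_right (fderiv ℝ f x) (fderiv ℝ f y)
      (TopologicalSpace.denseSeq (H →L[ℝ] E) k)]

/-- The area formula for Lipschitz maps that do not decrease distances. -/
theorem comap_euclideanHausdorffMeasure_eq_withDensity {f : H → E} {C : NNReal}
    (hf : LipschitzWith C f) (hexp : ∀ x y, ‖x - y‖ ≤ ‖f x - f y‖)
    (hexp' : ∀ x, DifferentiableAt ℝ f x → ∀ v, ‖v‖ ≤ ‖fderiv ℝ f x v‖) :
    (μHE[finrank ℝ H]).comap f =
      volume.withDensity fun x => ENNReal.ofReal (fderiv ℝ f x).toLinearMap.normDet := by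
  set n := finrank ℝ H
  set J : H → ENNReal := fun x => ENNReal.ofReal (fderiv ℝ f x).toLinearMap.normDet with hJ
  have hinj : Function.Injective f := fun x y hxy => by
    have := hexp x y
    rw [hxy, sub_self, norm_zero] at this
    exact sub_eq_zero.1 (norm_le_zero_iff.1 this)
  have hemb : MeasurableEmbedding f := hf.continuous.measurableEmbedding hinj
  have hnull : volume {x | DifferentiableAt ℝ f x}ᶜ = 0 := hf.ae_differentiableAt
  have hnull' : (μHE[n]).comap f {x | DifferentiableAt ℝ f x}ᶜ = 0 := by
    rw [hemb.comap_apply]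
    refine le_antisymm ((hf.lipschitzOnWith.euclideanHausdorffMeasure_image_le n).trans ?_) zero_le
    rw [InnerProductSpace.euclideanHausdorffMeasure_eq_volume, hnull, mul_zero]
  -- One factor `(1 + 2δ)ⁿ` pays for replacing `f` by its linear approximation, the other for
  -- replacing the Jacobian of that approximation by `J`. Since `f` and its derivatives do not
  -- shrink lengths, additive errors of size `δ‖v‖` become multiplicative ones.
  have key : ∀ δ : NNReal, δ ≠ 0 →
      (μHE[n]).comap f ≤ (((1 + 2 * δ : NNReal) : ENNReal) ^ n * ((1 + 2 * δ : NNReal) : ENNReal) ^ n) • volume.withDensity J ∧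
      volume.withDensity J ≤ (((1 + 2 * δ : NNReal) : ENNReal) ^ n * ((1 + 2 * δ : NNReal) : ENNReal) ^ n) • (μHE[n]).comap f := by
    intro δ hδ
    obtain ⟨p, A, hpm, hcov, hp⟩ := exists_nearly_linear_cover (f := f) hδ
    set c : NNReal := 1 + 2 * δ with hc
    have hcr : (c : ℝ) = 1 + 2 * δ := by simp [hc]
    have hA : ∀ i, (p i).Nonempty → ∀ v, ‖v‖ ≤ ‖A i v‖ := by
      intro i hi v
      obtain ⟨⟨y, hy, hAy⟩, -⟩ := hp i hi
      rw [hAy]; exact hexp' y hy v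
    have hAJ : ∀ i, ∀ x ∈ p i, ENNReal.ofReal (A i).toLinearMap.normDet ≤ (c : ENNReal) ^ n * J x ∧
        J x ≤ (c : ENNReal) ^ n * ENNReal.ofReal (A i).toLinearMap.normDet := by
      intro i x hx
      obtain ⟨-, h2, -⟩ := hp i ⟨x, hx⟩
      have hb : ∀ v, ‖fderiv ℝ f x v - A i v‖ ≤ 2 * δ * ‖v‖ := fun v =>
        ((fderiv ℝ f x - A i).le_opNorm v).trans (by gcongr; exact (h2 x hx).2)
      refine ⟨normDet_le_of_norm_le fun v => ?_, normDet_le_of_norm_le fun v => ?_⟩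
      · have h3 := norm_sub_norm_le (A i v) (fderiv ℝ f x v)
        rw [norm_sub_rev] at h3
        have h4 := hexp' x (h2 x hx).1 v
        have h5 := hb v
        have : 2 * (δ : ℝ) * ‖v‖ ≤ 2 * δ * ‖fderiv ℝ f x v‖ := by gcongr
        rw [hcr]; linarith
      · have h3 := norm_sub_norm_le (fderiv ℝ f x v) (A i v)
        have h4 := hA i ⟨x, hx⟩ v
        have h5 := hb v
        have : 2 * (δ : ℝ) * ‖v‖ ≤ 2 * δ * ‖A i v‖ := by gcongr
        rw [hcr]; linarith
    have hAf : ∀ i, ∀ x ∈ p i, ∀ y ∈ p i, dist (f x) (f y) ≤ c * dist ((A i).toLinearMap x) ((A i).toLinearMap y) ∧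
        dist ((A i).toLinearMap x) ((A i).toLinearMap y) ≤ c * dist (f x) (f y) := by
      intro i x hx y hy
      obtain ⟨-, -, h3⟩ := hp i ⟨x, hx⟩
      have h4 := h3 x hx y hy
      have h5 := hA i ⟨x, hx⟩ (x - y)
      have h6 := hexp x y
      have h7 : (δ : ℝ) * ‖x - y‖ ≤ δ * ‖A i (x - y)‖ := by gcongr
      have h8 : (δ : ℝ) * ‖x - y‖ ≤ δ * ‖f x - f y‖ := by gcongr
      have h9 := norm_sub_norm_le (f x - f y) (A i (x - y))
      have h10 := norm_sub_norm_le (A i (x - y)) (f x - f y)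
      rw [norm_sub_rev (A i (x - y))] at h10
      have h11 : 0 ≤ (δ : ℝ) * ‖A i (x - y)‖ := by positivity
      have h12 : 0 ≤ (δ : ℝ) * ‖f x - f y‖ := by positivity
      simp only [dist_eq_norm, ← map_sub, hcr, ContinuousLinearMap.coe_coe]
      constructor <;> linarith
    constructor
    · refine Measure.le_of_countable_cover p hpm ?_ fun i u hu hum => ?_
      · exact measure_mono_null (compl_subset_compl.2 hcov) hnull'
      rw [hemb.comap_apply, Measure.smul_apply, withDensity_apply _ hum, smul_eq_mul, mul_assoc]
      refine (euclideanHausdorffMeasure_image_le_of_dist_le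
        (fun x hx y hy => (hAf i x (hu hx) y (hu hy)).1) n).trans ?_
      gcongr
      rw [LinearMap.euclideanHausdorffMeasure_image_eq_normDet_mul_volume, ← setLIntegral_const,
        ← lintegral_const_mul' _ _ (by finiteness)]
      exact setLIntegral_mono' hum fun x hx => (hAJ i x (hu hx)).1
    · refine Measure.le_of_countable_cover p hpm ?_ fun i u hu hum => ?_
      · exact measure_mono_null (compl_subset_compl.2 hcov) (withDensity_absolutelyContinuous _ _ hnull)
      rw [Measure.smul_apply, hemb.comap_apply, withDensity_apply _ hum, smul_eq_mul, mul_assoc]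
      refine (setLIntegral_mono' hum fun x hx => (hAJ i x (hu hx)).2).trans ?_
      rw [lintegral_const_mul' _ _ (by finiteness)]
      gcongr
      rw [setLIntegral_const, ← LinearMap.euclideanHausdorffMeasure_image_eq_normDet_mul_volume]
      exact euclideanHausdorffMeasure_image_le_of_dist_le
        (fun x hx y hy => (hAf i x (hu hx) y (hu hy)).2) n
  have hlim : ∀ b : ENNReal, Tendsto (fun k : ℕ => (((1 + 2 * (1 / ((k : NNReal) + 1)) : NNReal) : ENNReal) ^ n *
      ((1 + 2 * (1 / ((k : NNReal) + 1)) : NNReal) : ENNReal) ^ n) * b) atTop (𝓝 b) := by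
    intro b
    have h0 : Tendsto (fun k : ℕ => (1 / ((k : NNReal) + 1))) atTop (𝓝 0) :=
      tendsto_one_div_add_atTop_nhds_zero_nat
    have h1 : Tendsto (fun k : ℕ => ((1 + 2 * (1 / ((k : NNReal) + 1))) ^ n * (1 + 2 * (1 / ((k : NNReal) + 1))) ^ n : NNReal))
        atTop (𝓝 ((1 + 2 * 0) ^ n * (1 + 2 * 0) ^ n)) :=
      (((h0.const_mul 2).const_add 1).pow n).mul (((h0.const_mul 2).const_add 1).pow n)
    simp only [mul_zero, add_zero, one_pow, mul_one] at h1
    have h2 := ENNReal.Tendsto.mul_const (b := b) (ENNReal.tendsto_coe.2 h1) (by simp)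
    simpa using h2
  refine le_antisymm (Measure.le_iff.2 fun s _ => ?_) (Measure.le_iff.2 fun s _ => ?_)
  · exact ge_of_tendsto' (hlim _) fun k => (key (1 / ((k : NNReal) + 1)) (by positivity)).1 s
  · exact ge_of_tendsto' (hlim _) fun k => (key (1 / ((k : NNReal) + 1)) (by positivity)).2 s

end AreaFormula


/-! ### Graph coordinates and the componentwise divergence theorem on epigraphs. -/

section Graph

variable {H E : Type*} [NormedAddCommGroup H] [InnerProductSpace ℝ H] [FiniteDimensional ℝ H]
  [MeasurableSpace H] [BorelSpace H] [NormedAddCommGroup E] [InnerProductSpace ℝ E]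
  [FiniteDimensional ℝ E] [MeasurableSpace E] [BorelSpace E]

/-- Graph coordinates: the hyperplane orthogonal to the unit vector `e` is parametrized by the
isometry `A`, and `g` is a Lipschitz function which is constant along the lines parallel to `e`. -/
structure GraphFrame (A : H →ₗᵢ[ℝ] E) (e : E) (g : E → ℝ) (K : NNReal) : Prop where
  norm_eq_one : ‖e‖ = 1
  inner_eq_zero : ∀ y, inner ℝ e (A y) = 0
  finrank_eq : finrank ℝ E = finrank ℝ H + 1
  lipschitz : LipschitzWith K g
  add_smul : ∀ (x : E) (t : ℝ), g (x + t • e) = g x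

/-- The point at height `t` above the graph of `g`, over the point `y` of the hyperplane. -/
def graphPoint (A : H →ₗᵢ[ℝ] E) (e : E) (g : E → ℝ) (y : H) (t : ℝ) : E :=
  A y + (g (A y) + t) • e

/-- The height above the graph of `g`. -/
def graphHeight (e : E) (g : E → ℝ) (x : E) : ℝ := inner ℝ e x - g x

/-- The outward normal vector of the epigraph of `g`, not normalized. -/
noncomputable def graphNormal (A : H →ₗᵢ[ℝ] E) (e : E) (g : E → ℝ) (y : H) : E :=
  A (gradient (fun z => g (A z)) y) - e

namespace GraphFrame

variable {A : H →ₗᵢ[ℝ] E} {e : E} {g : E → ℝ} {K : NNReal}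

lemma inner_self (h : GraphFrame A e g K) : inner ℝ e e = 1 := by
  rw [real_inner_self_eq_norm_sq, h.norm_eq_one, one_pow]

lemma inner_eq_zero' (h : GraphFrame A e g K) (y : H) : inner ℝ (A y) e = 0 := by
  rw [real_inner_comm, h.inner_eq_zero]

lemma norm_sq_add_smul (h : GraphFrame A e g K) (y : H) (t : ℝ) :
    ‖A y + t • e‖ ^ 2 = ‖y‖ ^ 2 + t ^ 2 := by
  rw [norm_add_sq_real, inner_smul_right, h.inner_eq_zero', norm_smul, h.norm_eq_one,
    A.norm_map]
  simp

lemma norm_le_norm_add_smul (h : GraphFrame A e g K) (y : H) (t : ℝ) : ‖y‖ ≤ ‖A y + t • e‖ := by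
  refine le_of_sq_le_sq ?_ (norm_nonneg _)
  rw [h.norm_sq_add_smul]
  nlinarith [sq_nonneg t]

/-- The orthogonal decomposition of the space along the frame. -/
noncomputable def equiv (h : GraphFrame A e g K) : WithLp 2 (H × ℝ) ≃ₗᵢ[ℝ] E :=
  LinearIsometry.toLinearIsometryEquiv
    { toFun := fun p => A p.fst + p.snd • e
      map_add' := fun p q => by simp [_root_.add_smul]; abel
      map_smul' := fun c p => by simp [smul_smul]
      norm_map' := fun p => by
        rw [← sq_eq_sq₀ (norm_nonneg _) (norm_nonneg _), WithLp.prod_norm_sq_eq_of_L2]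
        simp [h.norm_sq_add_smul] }
    (by rw [h.finrank_eq, LinearEquiv.finrank_eq (WithLp.linearEquiv 2 ℝ (H × ℝ))]; simp)

lemma equiv_apply (h : GraphFrame A e g K) (p : WithLp 2 (H × ℝ)) :
    h.equiv p = A p.fst + p.snd • e := rfl

lemma exists_eq (h : GraphFrame A e g K) (x : E) : ∃ y, x = A y + (inner ℝ e x : ℝ) • e := by
  obtain ⟨p, rfl⟩ := h.equiv.surjective x
  refine ⟨p.fst, ?_⟩
  rw [equiv_apply, inner_add_right, inner_smul_right, h.inner_eq_zero, h.inner_self]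
  simp

lemma exists_eq_graphPoint (h : GraphFrame A e g K) (x : E) :
    ∃ y, x = graphPoint A e g y (graphHeight e g x) := by
  obtain ⟨y, hy⟩ := h.exists_eq x
  refine ⟨y, ?_⟩
  have : g x = g (A y) := by
    conv_lhs => rw [hy]
    rw [h.add_smul]
  rw [graphPoint, graphHeight, this, add_sub_cancel]
  exact hy

lemma apply_graphPoint (h : GraphFrame A e g K) (y : H) (t : ℝ) :
    g (graphPoint A e g y t) = g (A y) := h.add_smul _ _

lemma graphHeight_graphPoint (h : GraphFrame A e g K) (y : H) (t : ℝ) :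
    graphHeight e g (graphPoint A e g y t) = t := by
  rw [graphHeight, h.apply_graphPoint, graphPoint, inner_add_right, inner_smul_right,
    h.inner_eq_zero, h.inner_self]
  ring

lemma continuous_graphPoint (h : GraphFrame A e g K) :
    Continuous fun p : H × ℝ => graphPoint A e g p.1 p.2 := by
  have := h.lipschitz.continuous
  have := A.continuous
  unfold graphPoint
  fun_prop

lemma continuous_graphPoint_left (h : GraphFrame A e g K) (t : ℝ) :
    Continuous fun y => graphPoint A e g y t :=
  h.continuous_graphPoint.comp (continuous_id.prodMk continuous_const)

lemma continuous_graphHeight (h : GraphFrame A e g K) : Continuous (graphHeight e g) := by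
  have := h.lipschitz.continuous
  unfold graphHeight
  fun_prop

lemma injective_graphPoint (h : GraphFrame A e g K) :
    Function.Injective fun p : H × ℝ => graphPoint A e g p.1 p.2 := by
  rintro ⟨y, t⟩ ⟨y', t'⟩ hp
  have ht : t = t' := by
    rw [← h.graphHeight_graphPoint y t, ← h.graphHeight_graphPoint y' t']
    exact congrArg _ hp
  have h1 : g (A y) = g (A y') := by
    rw [← h.apply_graphPoint y t, ← h.apply_graphPoint y' t']
    exact congrArg _ hp
  simp only [graphPoint, h1, ht, add_left_inj] at hp
  simp [A.injective hp, ht]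

lemma measurableEmbedding_graphPoint (h : GraphFrame A e g K) :
    MeasurableEmbedding fun p : H × ℝ => graphPoint A e g p.1 p.2 :=
  h.continuous_graphPoint.measurableEmbedding h.injective_graphPoint

/-- A shear, which translates every fibre, followed by an isometry: volume is preserved although `g`
is only Lipschitz. -/
lemma measurePreserving_graphPoint (h : GraphFrame A e g K) :
    MeasurePreserving (fun p : H × ℝ => graphPoint A e g p.1 p.2) volume volume := by
  have h1 : MeasurePreserving (fun p : H × ℝ => (p.1, g (A p.1) + p.2))
      (volume.prod volume) (volume.prod volume) := by
    refine MeasurePreserving.skew_product (g := fun y t => g (A y) + t)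
      (MeasurePreserving.id _) ?_ (ae_of_all _ fun y => ?_)
    · have := h.lipschitz.continuous
      have := A.continuous
      exact Continuous.measurable (by fun_prop)
    · exact map_add_left_eq_self _ _
  have h2 := (LinearIsometryEquiv.measurePreserving h.equiv).comp
    ((WithLp.volume_preserving_toLp H ℝ).comp h1)
  exact h2

lemma preimage_graphHeight_Ioi (h : GraphFrame A e g K) (t : ℝ) :
    (fun p : H × ℝ => graphPoint A e g p.1 p.2) ⁻¹' {x | t < graphHeight e g x} =
      univ ×ˢ Ioi t := by
  ext p
  simp [h.graphHeight_graphPoint]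

lemma setIntegral_eq (h : GraphFrame A e g K) {F : Type*} [NormedAddCommGroup F]
    [NormedSpace ℝ F] (f : E → F) (t : ℝ) :
    ∫ x in {x | t < graphHeight e g x}, f x =
      ∫ p in univ ×ˢ Ioi t, f (graphPoint A e g p.1 p.2) ∂(volume.prod volume : Measure (H × ℝ)) := by
  rw [← h.preimage_graphHeight_Ioi t]
  exact (h.measurePreserving_graphPoint.setIntegral_preimage_emb
    h.measurableEmbedding_graphPoint _ _).symm

/-- Forgetting the component along `e` does not increase distances, so the graph map is
antilipschitz with constant 1. -/
lemma isClosedEmbedding_graphPoint (h : GraphFrame A e g K) (t : ℝ) :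
    IsClosedEmbedding fun y => graphPoint A e g y t := by
  have hp : ∀ y y', ‖y - y'‖ ≤ ‖graphPoint A e g y t - graphPoint A e g y' t‖ := fun y y' => by
    have := h.norm_le_norm_add_smul (y - y') (g (A y) - g (A y'))
    convert this using 2
    simp only [graphPoint, map_sub]
    module
  have hL : LipschitzWith (1 + K * 1 * 1) fun y => graphPoint A e g y t := by
    refine A.lipschitz.add ?_
    refine LipschitzWith.of_dist_le_mul fun y y' => ?_
    rw [dist_eq_norm, ← sub_smul, norm_smul, h.norm_eq_one, mul_one, add_sub_add_right_eq_sub,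
      mul_one, mul_one]
    exact (h.lipschitz.dist_le_mul _ _).trans_eq (by rw [A.dist_map])
  refine AntilipschitzWith.isClosedEmbedding (K := 1) (AntilipschitzWith.of_le_mul_dist fun y y' => ?_)
    hL.uniformContinuous
  simpa [dist_eq_norm] using hp y y'

lemma lipschitz_comp (h : GraphFrame A e g K) : LipschitzWith K fun z => g (A z) := by
  rw [← mul_one K]
  exact h.lipschitz.comp A.lipschitz

lemma inner_graphNormal_e (h : GraphFrame A e g K) (y : H) :
    inner ℝ (graphNormal A e g y) e = -1 := by
  rw [graphNormal, inner_sub_left, h.inner_eq_zero', h.inner_self, zero_sub]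

lemma inner_graphNormal_map (h : GraphFrame A e g K) (y v : H) :
    inner ℝ (graphNormal A e g y) (A v) = fderiv ℝ (fun z => g (A z)) y v := by
  rw [graphNormal, inner_sub_left, h.inner_eq_zero, sub_zero, A.inner_map_map, gradient,
    InnerProductSpace.toDual_symm_apply]

lemma measurable_graphNormal (A : H →ₗᵢ[ℝ] E) (e : E) (g : E → ℝ) :
    Measurable (graphNormal A e g) := by
  refine Measurable.sub_const (A.continuous.measurable.comp ?_) e
  exact ((InnerProductSpace.toDual ℝ H).symm.continuous.measurable).comp (measurable_fderiv ℝ _)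

lemma norm_graphNormal_sq (h : GraphFrame A e g K) (y : H) :
    ‖graphNormal A e g y‖ ^ 2 = 1 + ‖gradient (fun z => g (A z)) y‖ ^ 2 := by
  have := h.norm_sq_add_smul (gradient (fun z => g (A z)) y) (-1)
  rw [graphNormal, sub_eq_add_neg, ← neg_one_smul ℝ e, this]
  ring

lemma one_le_norm_graphNormal (h : GraphFrame A e g K) (y : H) :
    1 ≤ ‖graphNormal A e g y‖ := by
  refine le_of_sq_le_sq ?_ (norm_nonneg _)
  rw [h.norm_graphNormal_sq]
  nlinarith [sq_nonneg ‖gradient (fun z => g (A z)) y‖]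

lemma norm_graphNormal_le (h : GraphFrame A e g K) (y : H) :
    ‖graphNormal A e g y‖ ≤ K + 1 := by
  refine (norm_sub_le _ _).trans ?_
  rw [h.norm_eq_one, A.norm_map, gradient, LinearIsometryEquiv.norm_map]
  gcongr
  exact norm_fderiv_le_of_lipschitz ℝ h.lipschitz_comp

lemma hasFDerivAt_graphPoint {y : H}
    (hy : DifferentiableAt ℝ (fun z => g (A z)) y) (t : ℝ) :
    HasFDerivAt (fun z => graphPoint A e g z t)
      (A.toContinuousLinearMap + (fderiv ℝ (fun z => g (A z)) y).smulRight e) y :=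
  (A.toContinuousLinearMap.hasFDerivAt).add ((hy.hasFDerivAt.add_const t).smul_const e)

section Divergence

variable {f : E → ℝ}

lemma hasCompactSupport_fderiv_apply (hfc : HasCompactSupport f) (w : E) :
    HasCompactSupport fun x => fderiv ℝ f x w :=
  hfc.fderiv_apply (𝕜 := ℝ) w

lemma continuous_fderiv_apply_const (hf : ContDiff ℝ 1 f) (w : E) :
    Continuous fun x => fderiv ℝ f x w :=
  (hf.continuous_fderiv one_ne_zero).clm_apply continuous_const

lemma integral_Ioi_fderiv (h : GraphFrame A e g K) (hf : ContDiff ℝ 1 f)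
    (hfc : HasCompactSupport f) (y : H) (t : ℝ) :
    ∫ s in Ioi t, fderiv ℝ f (graphPoint A e g y s) e = -f (graphPoint A e g y t) := by
  have hG : ∀ s, HasDerivAt (fun s => graphPoint A e g y s) e s := fun s => by
    have := (((hasDerivAt_id s).const_add (g (A y))).smul_const e).const_add (A y)
    simpa [graphPoint] using this
  have hd : ∀ s, HasDerivAt (fun s => f (graphPoint A e g y s))
      (fderiv ℝ f (graphPoint A e g y s) e) s := fun s =>
    ((hf.differentiable one_ne_zero _).hasFDerivAt).comp_hasDerivAt s (hG s)
  have hcd : ContDiff ℝ 1 fun s => f (graphPoint A e g y s) := by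
    unfold graphPoint
    fun_prop
  have hce : IsClosedEmbedding fun s => graphPoint A e g y s := by
    refine Isometry.isClosedEmbedding (Isometry.of_dist_eq fun s s' => ?_)
    rw [dist_eq_norm, graphPoint, graphPoint, add_sub_add_left_eq_sub, ← sub_smul, norm_smul,
      h.norm_eq_one, mul_one, add_sub_add_left_eq_sub, Real.dist_eq, Real.norm_eq_abs]
  have := (hfc.comp_isClosedEmbedding hce).integral_Ioi_deriv_eq hcd t
  rw [← this]
  exact integral_congr_ae (ae_of_all _ fun s => ((hd s).deriv).symm)

lemma integrable_fderiv_graphPoint (h : GraphFrame A e g K) (hf : ContDiff ℝ 1 f)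
    (hfc : HasCompactSupport f) (w : E) :
    Integrable (fun p : H × ℝ => fderiv ℝ f (graphPoint A e g p.1 p.2) w)
      (volume.prod volume) := by
  have h1 : Integrable (fun x => fderiv ℝ f x w) :=
    (continuous_fderiv_apply_const hf w).integrable_of_hasCompactSupport
      (hasCompactSupport_fderiv_apply hfc w)
  exact (h.measurePreserving_graphPoint.integrable_comp_emb h.measurableEmbedding_graphPoint).2 h1

/-- The function `f` restricted to the graph shifted by `s` is Lipschitz with compact support, so
its derivative along `v` has integral zero. By Rademacher and the chain rule that derivative is a.e.
the sum of the derivative along `A v` and the slope of `g` times the derivative along `e`. -/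
lemma integral_fderiv_map (h : GraphFrame A e g K) (hf : ContDiff ℝ 1 f)
    (hfc : HasCompactSupport f) (v : H) (s : ℝ) :
    ∫ y, fderiv ℝ f (graphPoint A e g y s) (A v) =
      ∫ y, -(fderiv ℝ (fun z => g (A z)) y v * fderiv ℝ f (graphPoint A e g y s) e) := by
  have hce := h.isClosedEmbedding_graphPoint s
  have hint : ∀ w, Integrable fun y => fderiv ℝ f (graphPoint A e g y s) w := fun w =>
    ((continuous_fderiv_apply_const hf w).comp
      hce.continuous).integrable_of_hasCompactSupport
        ((hasCompactSupport_fderiv_apply hfc w).comp_isClosedEmbedding hce)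
  obtain ⟨D, hD⟩ := hf.lipschitzWith_of_hasCompactSupport hfc one_ne_zero
  have hL : LipschitzWith (D * (1 + K * 1 * 1)) fun y => f (graphPoint A e g y s) := by
    refine hD.comp (A.lipschitz.add (LipschitzWith.of_dist_le_mul fun y y' => ?_))
    rw [dist_eq_norm, ← sub_smul, norm_smul, h.norm_eq_one, mul_one, add_sub_add_right_eq_sub,
      mul_one, mul_one]
    exact h.lipschitz_comp.dist_le_mul _ _
  -- Integration by parts against the constant 1; the direction is `-v` because the formula reverses
  -- it on the other factor.
  have h0 := LipschitzWith.integral_lineDeriv_mul_eq (μ := (volume : Measure H)) (LipschitzWith.const (1 : ℝ)) hL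
    (hfc.comp_isClosedEmbedding hce) (-v)
  have hc0 : ∀ x : H, lineDeriv ℝ (fun _ : H => (1 : ℝ)) x (-v) = 0 := fun x => by
    simp [lineDeriv]
  simp only [hc0, zero_mul, integral_zero, neg_neg, mul_one] at h0
  have h1 : ∀ᵐ y, lineDeriv ℝ (fun y => f (graphPoint A e g y s)) y v =
      fderiv ℝ f (graphPoint A e g y s) (A v) +
        fderiv ℝ (fun z => g (A z)) y v * fderiv ℝ f (graphPoint A e g y s) e := by
    filter_upwards [h.lipschitz_comp.ae_differentiableAt] with y hy
    have h2 := ((hf.differentiable one_ne_zero _).hasFDerivAt).comp y (hasFDerivAt_graphPoint (A := A) (e := e) hy s)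
    refine ((h2.hasLineDerivAt v).lineDeriv).trans ?_
    simp
  have h3 : Integrable fun y => fderiv ℝ (fun z => g (A z)) y v *
      fderiv ℝ f (graphPoint A e g y s) e := by
    refine (hint e).bdd_mul (c := K * ‖v‖) (measurable_fderiv_apply_const ℝ _ v).aestronglyMeasurable
      (ae_of_all _ fun y => ?_)
    exact (ContinuousLinearMap.le_opNorm _ _).trans
      (by gcongr; exact norm_fderiv_le_of_lipschitz ℝ h.lipschitz_comp)
  rw [integral_congr_ae h1, integral_add (hint _) h3] at h0
  rw [integral_neg]
  linarith

/-- The divergence theorem on the epigraph of a Lipschitz function, for one component. -/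
theorem setIntegral_fderiv (h : GraphFrame A e g K) (hf : ContDiff ℝ 1 f)
    (hfc : HasCompactSupport f) (w : E) (t : ℝ) :
    ∫ x in {x | t < graphHeight e g x}, fderiv ℝ f x w =
      ∫ y, f (graphPoint A e g y t) * inner ℝ (graphNormal A e g y) w := by
  have hce := h.isClosedEmbedding_graphPoint t
  have hfi : Integrable fun y => f (graphPoint A e g y t) :=
    (hf.continuous.comp hce.continuous).integrable_of_hasCompactSupport
      (hfc.comp_isClosedEmbedding hce)
  -- Vertical directions: the inner integral along each vertical line is a boundary value.
  have hE : ∀ c : ℝ, ∫ x in {x | t < graphHeight e g x}, fderiv ℝ f x (c • e) =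
      ∫ y, f (graphPoint A e g y t) * inner ℝ (graphNormal A e g y) (c • e) := by
    intro c
    rw [h.setIntegral_eq, setIntegral_prod _ (h.integrable_fderiv_graphPoint hf hfc _).integrableOn,
      setIntegral_univ]
    refine integral_congr_ae (ae_of_all _ fun y => ?_)
    simp only [map_smul, smul_eq_mul, inner_smul_right, h.inner_graphNormal_e]
    rw [integral_const_mul, h.integral_Ioi_fderiv hf hfc]
    ring
  -- Horizontal directions: integrating first over the hyperplane trades the horizontal derivative
  -- for a multiple of the vertical one, with a coefficient independent of the height. After
  -- swapping the integrals, the vertical argument applies.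
  have hA : ∀ v : H, ∫ x in {x | t < graphHeight e g x}, fderiv ℝ f x (A v) =
      ∫ y, f (graphPoint A e g y t) * inner ℝ (graphNormal A e g y) (A v) := by
    intro v
    have hi : Integrable (fun p : H × ℝ => -(fderiv ℝ (fun z => g (A z)) p.1 v *
        fderiv ℝ f (graphPoint A e g p.1 p.2) e)) (volume.prod volume) := by
      refine ((h.integrable_fderiv_graphPoint hf hfc e).bdd_mul (c := K * ‖v‖) ?_
        (ae_of_all _ fun y => ?_)).neg
      · exact ((measurable_fderiv_apply_const ℝ _ v).comp measurable_fst).aestronglyMeasurable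
      · exact (ContinuousLinearMap.le_opNorm _ _).trans
          (by gcongr; exact norm_fderiv_le_of_lipschitz ℝ h.lipschitz_comp)
    have hr : (volume.prod volume : Measure (H × ℝ)).restrict (univ ×ˢ Ioi t) =
        volume.prod (volume.restrict (Ioi t)) := by
      rw [← Measure.prod_restrict, Measure.restrict_univ]
    rw [h.setIntegral_eq, hr, integral_prod_symm _
      (by rw [← hr]; exact (h.integrable_fderiv_graphPoint hf hfc _).integrableOn)]
    simp_rw [h.integral_fderiv_map hf hfc]
    rw [← integral_integral_swap (f := fun y s => -(fderiv ℝ (fun z => g (A z)) y v *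
      fderiv ℝ f (graphPoint A e g y s) e)) (by rw [← hr]; exact hi.integrableOn)]
    refine integral_congr_ae (ae_of_all _ fun y => ?_)
    simp only [h.inner_graphNormal_map]
    rw [integral_neg, integral_const_mul, h.integral_Ioi_fderiv hf hfc]
    ring
  obtain ⟨v, hv⟩ := h.exists_eq w
  have hb : ∀ w' : E, Integrable fun y => f (graphPoint A e g y t) *
      inner ℝ (graphNormal A e g y) w' := by
    intro w'
    refine hfi.mul_bdd (c := (K + 1) * ‖w'‖) ?_ (ae_of_all _ fun y => ?_)
    · exact ((measurable_graphNormal A e g).inner measurable_const).aestronglyMeasurable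
    · exact (norm_inner_le_norm _ _).trans (by gcongr; exact h.norm_graphNormal_le y)
  have hd : ∀ w' : E, IntegrableOn (fun x => fderiv ℝ f x w') {x | t < graphHeight e g x} :=
    fun w' => ((continuous_fderiv_apply_const hf w').integrable_of_hasCompactSupport
      (hasCompactSupport_fderiv_apply hfc w')).integrableOn
  rw [hv]
  simp only [map_add, inner_add_right, mul_add]
  rw [integral_add (hd _) (hd _), integral_add (hb _) (hb _), hA, hE]

end Divergence

end GraphFrame

end Graph


/-! ### The divergence, the surface element of a graph, and vector fields on epigraphs. -/

section GraphDivergence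

variable {H E : Type*} [NormedAddCommGroup H] [InnerProductSpace ℝ H] [FiniteDimensional ℝ H]
  [MeasurableSpace H] [BorelSpace H] [NormedAddCommGroup E] [InnerProductSpace ℝ E]
  [FiniteDimensional ℝ E] [MeasurableSpace E] [BorelSpace E]

/-- The divergence of a vector field. -/
noncomputable def divergence (F : E → E) (x : E) : ℝ :=
  LinearMap.trace ℝ E (fderiv ℝ F x).toLinearMap

lemma _root_.HasFDerivAt.divergence_eq {F : E → E} {F' : E →L[ℝ] E} {x : E}
    (h : HasFDerivAt F F' x) : divergence F x = LinearMap.trace ℝ E F'.toLinearMap := by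
  rw [divergence, h.fderiv]

lemma divergence_congr {F F' : E → E} {x : E} (h : F =ᶠ[𝓝 x] F') :
    divergence F x = divergence F' x := by
  rw [divergence, divergence, h.fderiv_eq]

lemma divergence_add {F G : E → E} {x : E} (hF : DifferentiableAt ℝ F x)
    (hG : DifferentiableAt ℝ G x) :
    divergence (fun y => F y + G y) x = divergence F x + divergence G x := by
  refine (hF.hasFDerivAt.add hG.hasFDerivAt).divergence_eq.trans ?_
  simp [divergence]

lemma divergence_sub {F G : E → E} {x : E} (hF : DifferentiableAt ℝ F x)
    (hG : DifferentiableAt ℝ G x) :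
    divergence (fun y => F y - G y) x = divergence F x - divergence G x := by
  refine (hF.hasFDerivAt.sub hG.hasFDerivAt).divergence_eq.trans ?_
  simp [divergence]

lemma divergence_sum {ι : Type*} {s : Finset ι} {F : ι → E → E} {x : E}
    (hF : ∀ i ∈ s, DifferentiableAt ℝ (F i) x) :
    divergence (fun y => ∑ i ∈ s, F i y) x = ∑ i ∈ s, divergence (F i) x := by
  rw [(HasFDerivAt.fun_sum fun i hi => (hF i hi).hasFDerivAt).divergence_eq]
  simp [divergence]

lemma divergence_smul {f : E → ℝ} {F : E → E} {x : E} (hf : DifferentiableAt ℝ f x)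
    (hF : DifferentiableAt ℝ F x) :
    divergence (fun y => f y • F y) x = f x * divergence F x + fderiv ℝ f x (F x) := by
  refine (hf.hasFDerivAt.smul hF.hasFDerivAt).divergence_eq.trans ?_
  simp only [divergence, ContinuousLinearMap.toLinearMap_add, ContinuousLinearMap.toLinearMap_smul,
    map_add, map_smul, smul_eq_mul]
  congr 1
  exact LinearMap.trace_smulRight _ _

namespace GraphFrame

variable {A : H →ₗᵢ[ℝ] E} {e : E} {g : E → ℝ} {K : NNReal}

/-- The Gram matrix of the derivative is the identity plus a rank-one matrix built from the slopes
of `g`, so its determinant is 1 + |∇g|². -/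
lemma normDet_eq_norm_graphNormal (h : GraphFrame A e g K) {y : H}
    (hy : DifferentiableAt ℝ (fun z => g (A z)) y) (t : ℝ) :
    (fderiv ℝ (fun z => graphPoint A e g z t) y).toLinearMap.normDet =
      ‖graphNormal A e g y‖ := by
  rw [← sq_eq_sq₀ (LinearMap.normDet_nonneg _) (norm_nonneg _), h.norm_graphNormal_sq,
    (hasFDerivAt_graphPoint hy t).fderiv]
  set l := fderiv ℝ (fun z => g (A z)) y
  set b := stdOrthonormalBasis ℝ H
  have h1 := LinearMap.normDet_sq_eq_det_gram
    (A.toContinuousLinearMap + l.smulRight e).toLinearMap b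
  have h2 : Matrix.gram ℝ (fun i => (A.toContinuousLinearMap + l.smulRight e).toLinearMap (b i)) =
      1 + Matrix.replicateCol Unit (fun i => l (b i)) * Matrix.replicateRow Unit (fun i => l (b i)) := by
    ext i j
    simp only [Matrix.gram_apply, ContinuousLinearMap.coe_coe, FunLike.coe_add, Pi.add_apply,
      ContinuousLinearMap.smulRight_apply, LinearIsometry.coe_toContinuousLinearMap,
      inner_add_left, inner_add_right, inner_smul_left, inner_smul_right, h.inner_eq_zero,
      h.inner_eq_zero', h.inner_self, A.inner_map_map, Matrix.add_apply, Matrix.mul_apply,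
      Matrix.replicateCol_apply, Matrix.replicateRow_apply, Matrix.one_apply,
      OrthonormalBasis.inner_eq_ite]
    simp [mul_comm]
  rw [h2, Matrix.det_one_add_replicateCol_mul_replicateRow] at h1
  simp only [RCLike.ofReal_real_eq_id, id_eq] at h1
  rw [h1]
  congr 1
  rw [← b.sum_sq_inner_right (gradient (fun z => g (A z)) y)]
  refine Finset.sum_congr rfl fun i _ => ?_
  rw [real_inner_comm, gradient, InnerProductSpace.toDual_symm_apply, sq]

/-- The surface measure on the graph of a Lipschitz function. -/
theorem restrict_euclideanHausdorffMeasure_range (h : GraphFrame A e g K) :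
    (μHE[finrank ℝ H]).restrict (range fun y => graphPoint A e g y 0) =
      (volume.withDensity fun y => ENNReal.ofReal ‖graphNormal A e g y‖).map
        fun y => graphPoint A e g y 0 := by
  have hemb : MeasurableEmbedding fun y => graphPoint A e g y 0 :=
    (h.isClosedEmbedding_graphPoint 0).measurableEmbedding
  have hexp : ∀ y y', ‖y - y'‖ ≤ ‖graphPoint A e g y 0 - graphPoint A e g y' 0‖ := fun y y' => by
    have := h.norm_le_norm_add_smul (y - y') (g (A y) - g (A y'))
    convert this using 2
    simp only [graphPoint, map_sub]
    module
  have hdiff : ∀ y, DifferentiableAt ℝ (fun y => graphPoint A e g y 0) y →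
      DifferentiableAt ℝ (fun z => g (A z)) y := by
    intro y hy
    have h1 : DifferentiableAt ℝ (fun z => (inner ℝ e (graphPoint A e g z 0) : ℝ)) y :=
      (differentiableAt_const e).inner ℝ hy
    have h2 : (fun z => (inner ℝ e (graphPoint A e g z 0) : ℝ)) = fun z => g (A z) := by
      ext z
      simp [graphPoint, inner_add_right, inner_smul_right, h.inner_eq_zero, h.norm_eq_one]
    rwa [h2] at h1
  have hL : LipschitzWith (1 + K * 1 * 1) fun y => graphPoint A e g y 0 := by
    refine A.lipschitz.add (LipschitzWith.of_dist_le_mul fun y y' => ?_)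
    rw [dist_eq_norm, ← sub_smul, norm_smul, h.norm_eq_one, mul_one, add_sub_add_right_eq_sub,
      mul_one, mul_one]
    exact h.lipschitz_comp.dist_le_mul _ _
  have harea := comap_euclideanHausdorffMeasure_eq_withDensity hL hexp fun y hy v => by
    rw [(hasFDerivAt_graphPoint (hdiff y hy) 0).fderiv]
    exact h.norm_le_norm_add_smul _ _
  have hae : (fun y => ENNReal.ofReal ‖graphNormal A e g y‖) =ᵐ[volume]
      fun y => ENNReal.ofReal (fderiv ℝ (fun z => graphPoint A e g z 0) y).toLinearMap.normDet := by
    filter_upwards [h.lipschitz_comp.ae_differentiableAt] with y hy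
    rw [h.normDet_eq_norm_graphNormal hy]
  rw [withDensity_congr_ae hae, ← harea, hemb.map_comap]

section Divergence

variable {F : E → E}

/-- The divergence theorem on the epigraph of a Lipschitz function, for smooth fields. -/
theorem setIntegral_divergence_of_contDiff (h : GraphFrame A e g K) (hF : ContDiff ℝ 1 F)
    (hFc : HasCompactSupport F) (t : ℝ) :
    ∫ x in {x | t < graphHeight e g x}, divergence F x =
      ∫ y, inner ℝ (graphNormal A e g y) (F (graphPoint A e g y t)) := by
  set b := stdOrthonormalBasis ℝ E
  have hf : ∀ i, ContDiff ℝ 1 fun x => (inner ℝ (b i) (F x) : ℝ) := fun i =>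
    contDiff_const.inner ℝ hF
  have hfc : ∀ i, HasCompactSupport fun x => (inner ℝ (b i) (F x) : ℝ) := fun i =>
    hFc.comp_left (g := fun v => (inner ℝ (b i) v : ℝ)) (inner_zero_right _)
  have hd : ∀ x, divergence F x = ∑ i, fderiv ℝ (fun x => (inner ℝ (b i) (F x) : ℝ)) x (b i) := by
    intro x
    rw [divergence, LinearMap.trace_eq_sum_inner _ b]
    refine Finset.sum_congr rfl fun i _ => ?_
    rw [fderiv_inner_apply ℝ (differentiableAt_const _) (hF.differentiable one_ne_zero x)]
    simp
  have hn : ∀ y, inner ℝ (graphNormal A e g y) (F (graphPoint A e g y t)) =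
      ∑ i, inner ℝ (b i) (F (graphPoint A e g y t)) * inner ℝ (graphNormal A e g y) (b i) := by
    intro y
    rw [← b.sum_inner_mul_inner]
    exact Finset.sum_congr rfl fun i _ => mul_comm _ _
  have hce := h.isClosedEmbedding_graphPoint t
  simp_rw [hd, hn]
  rw [integral_finsetSum, integral_finsetSum]
  · exact Finset.sum_congr rfl fun i _ => h.setIntegral_fderiv (hf i) (hfc i) (b i) t
  · intro i _
    have h1 : Integrable fun y => (inner ℝ (b i) (F (graphPoint A e g y t)) : ℝ) :=
      ((hf i).continuous.comp hce.continuous).integrable_of_hasCompactSupport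
        ((hfc i).comp_isClosedEmbedding hce)
    refine h1.mul_bdd (c := (K + 1) * ‖b i‖) ?_ (ae_of_all _ fun y => ?_)
    · exact ((measurable_graphNormal A e g).inner measurable_const).aestronglyMeasurable
    · exact (norm_inner_le_norm _ _).trans (by gcongr; exact h.norm_graphNormal_le y)
  · intro i _
    exact ((continuous_fderiv_apply_const (hf i) _).integrable_of_hasCompactSupport
      (hasCompactSupport_fderiv_apply (hfc i) _)).integrableOn

lemma _root_.exists_contDiff_cutoff {C U : Set E} (hC : IsCompact C) (hU : IsOpen U) (hCU : C ⊆ U) :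
    ∃ ψ : E → ℝ, ContDiff ℝ 1 ψ ∧ tsupport ψ ⊆ U ∧ ∀ x ∈ C, ψ x = 1 := by
  obtain ⟨f, hf⟩ := SmoothPartitionOfUnity.exists_isSubordinate (modelWithCornersSelf ℝ E)
    hC.isClosed (fun _ : Unit => U) (fun _ => hU) (hCU.trans (subset_iUnion (fun _ : Unit => U) ()))
  refine ⟨f (), ((f ()).contMDiff.contDiff).of_le (by simp), hf (), fun x hx => ?_⟩
  have := f.sum_eq_one hx
  rwa [finsum_unique] at this

lemma _root_.contDiff_smul_of_tsupport_subset {V : Type*} [NormedAddCommGroup V] [NormedSpace ℝ V]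
    {ψ : E → ℝ} {F : E → V} {U : Set E}
    (hU : IsOpen U) (hψ : ContDiff ℝ 1 ψ) (hψU : tsupport ψ ⊆ U) (hF : ContDiffOn ℝ 1 F U) :
    ContDiff ℝ 1 fun x => ψ x • F x := by
  rw [contDiff_iff_contDiffAt]
  intro x
  by_cases hx : x ∈ tsupport ψ
  · exact hψ.contDiffAt.smul (hF.contDiffAt (hU.mem_nhds (hψU hx)))
  · have : (fun x => ψ x • F x) =ᶠ[𝓝 x] fun _ => 0 := by
      filter_upwards [(isClosed_tsupport ψ).isOpen_compl.mem_nhds hx] with z hz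
      rw [image_eq_zero_of_notMem_tsupport hz, zero_smul]
    exact contDiffAt_const.congr_of_eventuallyEq this

/-- The field is C¹ only strictly above the graph. A cutoff equal to 1 on the compact part of `C` at
height at least `t` makes it globally C¹ and changes neither side of the formula. -/
theorem setIntegral_divergence_of_pos (h : GraphFrame A e g K)
    (hF : ContDiffOn ℝ 1 F {x | 0 < graphHeight e g x}) {C : Set E} (hC : IsCompact C)
    (hFC : ∀ x ∉ C, F x = 0) {t : ℝ} (ht : 0 < t) :
    ∫ x in {x | t < graphHeight e g x}, divergence F x =
      ∫ y, inner ℝ (graphNormal A e g y) (F (graphPoint A e g y t)) := by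
  have hU : IsOpen {x | 0 < graphHeight e g x} := isOpen_lt continuous_const h.continuous_graphHeight
  have hCt : IsCompact (C ∩ {x | t ≤ graphHeight e g x}) :=
    hC.inter_right (isClosed_le continuous_const h.continuous_graphHeight)
  obtain ⟨ψ, hψ, hψU, hψ1⟩ := exists_contDiff_cutoff hCt hU fun x hx => ht.trans_le hx.2
  have heq : ∀ x, t ≤ graphHeight e g x → ψ x • F x = F x := by
    intro x hx
    by_cases hxC : x ∈ C
    · rw [hψ1 x ⟨hxC, hx⟩, one_smul]
    · rw [hFC x hxC, smul_zero]
  have hc : HasCompactSupport fun x => ψ x • F x :=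
    HasCompactSupport.intro hC fun x hx => by rw [hFC x hx, smul_zero]
  have := h.setIntegral_divergence_of_contDiff (contDiff_smul_of_tsupport_subset hU hψ hψU hF) hc t
  have hVo : IsOpen {x | t < graphHeight e g x} := isOpen_lt continuous_const h.continuous_graphHeight
  convert this using 1
  · refine setIntegral_congr_fun hVo.measurableSet fun x hx => divergence_congr ?_
    filter_upwards [hVo.mem_nhds hx] with z hz
    exact (heq z hz.le).symm
  · refine integral_congr_ae (ae_of_all _ fun y => ?_)
    simp only
    rw [heq _ (h.graphHeight_graphPoint y t).ge]

/-- The divergence theorem on the epigraph of a Lipschitz function, for fields which are dominated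
by an integrable function along the vertical lines and have vertical limits at the graph. -/
theorem setIntegral_divergence (h : GraphFrame A e g K)
    (hF : ContDiffOn ℝ 1 F {x | 0 < graphHeight e g x}) {C : Set E} (hC : IsCompact C)
    (hFC : ∀ x ∉ C, F x = 0) {M : H → ENNReal} (hMm : Measurable M) (hM : ∫⁻ y, M y ≠ ⊤)
    (hdom : ∀ y t, 0 < t → ‖F (graphPoint A e g y t)‖ₑ ≤ M y)
    (hdiv : IntegrableOn (divergence F) {x | 0 < graphHeight e g x}) {B : H → E}
    (hB : ∀ᵐ y, Tendsto (fun t => F (graphPoint A e g y t)) (𝓝[>] 0) (𝓝 (B y))) :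
    Integrable (fun y => (inner ℝ (graphNormal A e g y) (B y) : ℝ)) ∧
      ∫ x in {x | 0 < graphHeight e g x}, divergence F x =
        ∫ y, inner ℝ (graphNormal A e g y) (B y) := by
  -- The formula is known at each height `τ k`. As these decrease to 0, the boundary side converges
  -- under the majorant `(K + 1) * M` and the interior side by exhaustion of the epigraph.
  set τ : ℕ → ℝ := fun k => 1 / ((k : ℝ) + 1) with hτ
  have hτ0 : ∀ k, 0 < τ k := fun k => by positivity
  have hτl : Tendsto τ atTop (𝓝[>] 0) :=
    tendsto_nhdsWithin_iff.2 ⟨tendsto_one_div_add_atTop_nhds_zero_nat, Eventually.of_forall hτ0⟩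
  have hmeas : ∀ k, AEStronglyMeasurable
      (fun y => (inner ℝ (graphNormal A e g y) (F (graphPoint A e g y (τ k))) : ℝ)) volume := by
    intro k
    refine ((measurable_graphNormal A e g).aestronglyMeasurable).inner
      (Continuous.aestronglyMeasurable ?_)
    refine hF.continuousOn.comp_continuous (h.continuous_graphPoint_left _) fun y => ?_
    rw [mem_ofPred_eq, h.graphHeight_graphPoint]
    exact hτ0 k
  have hMi : Integrable fun y => (K + 1) * (M y).toReal :=
    (integrable_toReal_of_lintegral_ne_top hMm.aemeasurable hM).const_mul _
  have hbound : ∀ k, ∀ᵐ y, ‖(inner ℝ (graphNormal A e g y) (F (graphPoint A e g y (τ k))) : ℝ)‖ ≤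
      (K + 1) * (M y).toReal := by
    intro k
    filter_upwards [ae_lt_top hMm hM] with y hy
    refine (norm_inner_le_norm _ _).trans ?_
    gcongr
    · exact h.norm_graphNormal_le y
    · rw [← toReal_enorm]
      exact ENNReal.toReal_mono hy.ne (hdom y _ (hτ0 k))
  have hlim : ∀ᵐ y, Tendsto (fun k => (inner ℝ (graphNormal A e g y)
      (F (graphPoint A e g y (τ k))) : ℝ)) atTop (𝓝 (inner ℝ (graphNormal A e g y) (B y))) := by
    filter_upwards [hB] with y hy
    exact tendsto_const_nhds.inner (hy.comp hτl)
  have hiB : Integrable (fun y => (inner ℝ (graphNormal A e g y) (B y) : ℝ)) := by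
    refine hMi.mono' (aestronglyMeasurable_of_tendsto_ae atTop hmeas hlim) ?_
    filter_upwards [hlim, ae_all_iff.2 hbound] with y h1 h2
    exact le_of_tendsto' h1.norm h2
  refine ⟨hiB, ?_⟩
  have h1 := tendsto_integral_of_dominated_convergence _ hmeas hMi hbound hlim
  have hUn : ⋃ k, {x | τ k < graphHeight e g x} = {x | 0 < graphHeight e g x} := by
    ext x
    simp only [mem_iUnion, mem_ofPred_eq]
    refine ⟨fun ⟨k, hk⟩ => (hτ0 k).trans hk, fun hx => ?_⟩
    exact ((tendsto_order.1 (tendsto_nhdsWithin_iff.1 hτl).1).2 _ hx).exists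
  have h2 : Tendsto (fun k => ∫ x in {x | τ k < graphHeight e g x}, divergence F x) atTop
      (𝓝 (∫ x in ⋃ k, {x | τ k < graphHeight e g x}, divergence F x)) := by
    refine tendsto_setIntegral_of_monotone (fun k => ?_) (fun k l hkl x hx => ?_) ?_
    · exact (isOpen_lt continuous_const h.continuous_graphHeight).measurableSet
    · refine lt_of_le_of_lt (b := τ k) ?_ hx.out
      exact one_div_le_one_div_of_le (by positivity) (by gcongr)
    · rwa [hUn]
  rw [hUn] at h2
  simp_rw [h.setIntegral_divergence_of_pos hF hC hFC (hτ0 _)] at h2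
  exact tendsto_nhds_unique h2 h1

end Divergence

end GraphFrame

end GraphDivergence


/-! ### Uniqueness of the normal; nontangential limits and maximal functions. -/

section Normal

variable {d : ℕ} {Ω : Set (Space d)}

/-- Move from `s` a little in the direction `n' - n`. The new point lies on the outer side for `n'`
and on the inner side for `n`, which is contradictory whether or not it belongs to `Ω`. -/
lemma IsOutwardNormal.unique {s n n' : Space d} (h : IsOutwardNormal Ω s n)
    (h' : IsOutwardNormal Ω s n') : n = n' := by
  by_contra hne
  have hc : inner ℝ n n' < 1 := inner_lt_one_iff_real_of_norm_eq_one h.1 h'.1 |>.2 hne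
  set c : ℝ := 1 - inner ℝ n n'
  have hc0 : 0 < c := sub_pos.2 hc
  set v := n' - n
  have h1 : inner ℝ n v = -c := by
    rw [inner_sub_right, real_inner_self_eq_norm_sq, h.1]; simp only [c]; ring
  have h2 : inner ℝ n' v = c := by
    rw [inner_sub_right, real_inner_self_eq_norm_sq, h'.1, real_inner_comm]; simp only [c]; ring
  have hv : ‖v‖ ≤ 2 := (norm_sub_le _ _).trans (by rw [h.1, h'.1]; norm_num)
  -- As `‖v‖ ≤ 2`, the error at step length `t` is at most `t * c / 2`, below the displacement `t *
  -- c`.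
  have hε : 0 < c / 4 := by positivity
  have hl : Tendsto (fun t : ℝ => s + t • v) (𝓝[>] 0) (𝓝 s) := by
    have : Tendsto (fun t : ℝ => s + t • v) (𝓝 0) (𝓝 (s + (0 : ℝ) • v)) :=
      Continuous.tendsto (by fun_prop) 0
    rw [zero_smul, add_zero] at this
    exact this.mono_left nhdsWithin_le_nhds
  obtain ⟨t, ⟨ht1, ht2⟩, ht0⟩ := ((hl.eventually ((h.2 _ hε).and (h'.2 _ hε))).and
    self_mem_nhdsWithin).exists
  have ht0' : 0 < t := ht0
  simp only [add_sub_cancel_left, inner_smul_right, norm_smul, Real.norm_eq_abs,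
    abs_of_pos ht0', h1, h2] at ht1 ht2
  have h3 : c / 4 * (t * ‖v‖) ≤ c / 4 * (t * 2) := by gcongr
  have h4 : 0 < t * c := by positivity
  by_cases hx : s + t • v ∈ Ω
  · have := ht2.1 hx; linarith
  · have := ht1.2 hx; linarith

lemma IsOutwardNormal.normal_eq {s n : Space d} (h : IsOutwardNormal Ω s n) :
    normal Ω s = n := by
  have hex : ∃ n, IsOutwardNormal Ω s n := ⟨n, h⟩
  rw [normal, dif_pos hex]
  exact hex.choose_spec.unique h

end Normal

section BoundaryValue

variable {d : ℕ} {Ω : Set (Space d)} {V : Type*} [NormedAddCommGroup V]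

lemma hasBoundaryValue_boundaryValue {F : Space d → V} {s : Space d}
    (h : ∃ L, HasBoundaryValue Ω F s L) : HasBoundaryValue Ω F s (boundaryValue Ω F s) := by
  rw [boundaryValue, dif_pos h]
  exact h.choose_spec

/-- For fixed `x` the boundary points whose approach region contains `x` form an open set. The
maximal function is thus a supremum of lower semicontinuous functions, whatever `F` is. -/
lemma measurable_maximalFunction (κ : ℝ) (F : Space d → V) :
    Measurable (maximalFunction Ω κ F) := by
  have h : LowerSemicontinuous (maximalFunction Ω κ F) := by
    refine lowerSemicontinuous_iSup fun x => ?_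
    have ho : IsOpen {s | x ∈ approachRegion Ω κ s} := by
      by_cases hx : x ∈ Ω
      · have : {s | x ∈ approachRegion Ω κ s} =
            {s | ‖x - s‖ < κ * Metric.infDist x (frontier Ω)} := by
          ext s; exact ⟨fun h => h.2, fun h => ⟨hx, h⟩⟩
        rw [this]
        exact isOpen_lt (by fun_prop) continuous_const
      · have : {s | x ∈ approachRegion Ω κ s} = ∅ := by
          ext s; exact ⟨fun h => hx h.1, fun h => h.elim⟩
        rw [this]
        exact isOpen_empty
    have heq : (fun s => ⨆ (_ : x ∈ approachRegion Ω κ s), ‖F x‖ₑ) =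
        indicator {s | x ∈ approachRegion Ω κ s} fun _ => ‖F x‖ₑ := by
      ext s
      by_cases hs : x ∈ approachRegion Ω κ s
      · rw [indicator_of_mem (by exact hs), iSup_pos hs]
      · rw [indicator_of_notMem (by exact hs), iSup_neg hs]
        rfl
    rw [heq]
    exact ho.lowerSemicontinuous_indicator zero_le
  exact h.measurable

lemma enorm_le_maximalFunction {κ : ℝ} {F : Space d → V} {x s : Space d}
    (h : x ∈ approachRegion Ω κ s) : ‖F x‖ₑ ≤ maximalFunction Ω κ F s :=
  le_iSup₂_of_le x h le_rfl

end BoundaryValue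

/-! ### Boundary charts: frontier, approach regions, normal and surface measure. -/

section Chart

variable {d : ℕ}

namespace GraphFrame

variable {H E : Type*} [NormedAddCommGroup H] [InnerProductSpace ℝ H] [FiniteDimensional ℝ H]
  [MeasurableSpace H] [BorelSpace H] [NormedAddCommGroup E] [InnerProductSpace ℝ E]
  [FiniteDimensional ℝ E] [MeasurableSpace E] [BorelSpace E]
  {A : H →ₗᵢ[ℝ] E} {e : E} {g : E → ℝ} {K : NNReal}

lemma abs_graphHeight_sub_le (h : GraphFrame A e g K) (x z : E) :
    |graphHeight e g x - graphHeight e g z| ≤ (1 + K) * ‖x - z‖ := by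
  have h1 : |(inner ℝ e (x - z) : ℝ)| ≤ ‖x - z‖ := by
    have := abs_real_inner_le_norm e (x - z)
    rwa [h.norm_eq_one, one_mul] at this
  have h2 : |g x - g z| ≤ K * ‖x - z‖ := by
    rw [← Real.dist_eq, ← dist_eq_norm]; exact h.lipschitz.dist_le_mul _ _
  have h3 : graphHeight e g x - graphHeight e g z = inner ℝ e (x - z) - (g x - g z) := by
    simp only [graphHeight, inner_sub_right]; ring
  rw [h3]
  exact (abs_sub _ _).trans (by linarith)

lemma graphHeight_add_smul (h : GraphFrame A e g K) (x : E) (t : ℝ) :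
    graphHeight e g (x + t • e) = graphHeight e g x + t := by
  rw [graphHeight, graphHeight, h.add_smul, inner_add_right, inner_smul_right, h.inner_self]
  ring

lemma graphPoint_eq_add (y : H) (t : ℝ) :
    graphPoint A e g y t = graphPoint A e g y 0 + t • e := by
  simp only [graphPoint]
  module

/-- Since `g` is constant along `e`, it factors through the adjoint of `A`, so differentiability at
`y` in the hyperplane gives differentiability on the whole vertical line over `y`. -/
lemma hasFDerivAt_graphHeight (h : GraphFrame A e g K) {y : H}
    (hy : DifferentiableAt ℝ (fun z => g (A z)) y) (t : ℝ) :
    HasFDerivAt (graphHeight e g) (-(innerSL ℝ (graphNormal A e g y))) (graphPoint A e g y t) := by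
  set P := ContinuousLinearMap.adjoint A.toContinuousLinearMap
  have hP : ∀ (z : H) (t : ℝ), P (A z + t • e) = z := by
    intro z t
    refine ext_inner_left ℝ fun w => ?_
    rw [ContinuousLinearMap.adjoint_inner_right, inner_add_right, inner_smul_right]
    simp [h.inner_eq_zero']
  have hg : ∀ x, g x = g (A (P x)) := by
    intro x
    obtain ⟨z, hz⟩ := h.exists_eq x
    conv_rhs => rw [hz, hP]
    conv_lhs => rw [hz, h.add_smul]
  have hPy : P (graphPoint A e g y t) = y := hP _ _
  have h1 : HasFDerivAt g ((fderiv ℝ (fun z => g (A z)) y).comp P) (graphPoint A e g y t) := by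
    have h2 : HasFDerivAt (fun z => g (A z)) (fderiv ℝ (fun z => g (A z)) y)
        (P (graphPoint A e g y t)) := by rw [hPy]; exact hy.hasFDerivAt
    exact (h2.comp (graphPoint A e g y t) P.hasFDerivAt).congr_of_eventuallyEq
      (Eventually.of_forall hg)
  have h4 := ((innerSL ℝ e).hasFDerivAt (x := graphPoint A e g y t)).sub h1
  refine h4.congr_fderiv (ContinuousLinearMap.ext fun w => ?_)
  simp only [FunLike.coe_neg, Pi.neg_apply, innerSL_apply_apply, FunLike.coe_sub, Pi.sub_apply,
    ContinuousLinearMap.comp_apply, graphNormal, inner_sub_left]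
  have h5 : inner ℝ (A (gradient (fun z => g (A z)) y)) w = fderiv ℝ (fun z => g (A z)) y (P w) := by
    have := ContinuousLinearMap.adjoint_inner_right A.toContinuousLinearMap
      (gradient (fun z => g (A z)) y) w
    rw [gradient, InnerProductSpace.toDual_symm_apply] at this
    exact this.symm
  rw [h5]
  ring

end GraphFrame

/-- In the ball of radius `r` around its boundary point `p`, the set `Ω` is the epigraph of `g`. -/
structure IsGraphChart (Ω : Set (Space d)) (A : Space (d - 1) →ₗᵢ[ℝ] Space d) (e : Space d)
    (g : Space d → ℝ) (K : NNReal) (p : Space d) (r : ℝ) : Prop where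
  frame : GraphFrame A e g K
  isOpen : IsOpen Ω
  radius_pos : 0 < r
  mem_frontier : p ∈ frontier Ω
  mem_iff : ∀ x ∈ Metric.ball p r, x ∈ Ω ↔ 0 < graphHeight e g x

lemma IsLipschitzDomain.exists_isGraphChart {Ω : Set (Space d)} (hΩ : IsLipschitzDomain Ω)
    (hd : 1 ≤ d) {p : Space d} (hp : p ∈ frontier Ω) :
    ∃ A e g K r, IsGraphChart Ω A e g K p r := by
  obtain ⟨e, he, K, g, hg, hinv, r, hr, heq⟩ := hΩ.graph p hp
  have hfact : Fact (finrank ℝ (Space d) = (d - 1) + 1) := ⟨by simp; omega⟩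
  have he0 : e ≠ 0 := fun h => by simp [h] at he
  set b := OrthonormalBasis.fromOrthogonalSpanSingleton (𝕜 := ℝ) (d - 1) he0
  set A : Space (d - 1) →ₗᵢ[ℝ] Space d :=
    (Submodule.subtypeₗᵢ (Submodule.span ℝ {e})ᗮ).comp b.repr.symm.toLinearIsometry
  refine ⟨A, e, g, K, r, ⟨⟨he, fun y => ?_, ?_, hg, hinv⟩, hΩ.isOpen, hr, hp, fun x hx => ?_⟩⟩
  · exact Submodule.mem_orthogonal_singleton_iff_inner_right.1 (b.repr.symm y).2
  · rw [hfact.out]; simp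
  · have : x ∈ Ω ∩ Metric.ball p r ↔ x ∈ {x | g x < inner ℝ e x} ∩ Metric.ball p r := by rw [heq]
    simp only [mem_inter_iff, hx, and_true] at this
    rw [this, graphHeight, sub_pos]
    exact Iff.rfl

namespace IsGraphChart

variable {Ω : Set (Space d)} {A : Space (d - 1) →ₗᵢ[ℝ] Space d} {e : Space d}
  {g : Space d → ℝ} {K : NNReal} {p : Space d} {r : ℝ}

lemma mem_frontier_iff (h : IsGraphChart Ω A e g K p r) {x : Space d} (hx : x ∈ Metric.ball p r) :
    x ∈ frontier Ω ↔ graphHeight e g x = 0 := by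
  rw [h.isOpen.frontier_eq, Set.mem_sdiff, h.mem_iff x hx, not_lt]
  constructor
  · rintro ⟨h1, h2⟩
    refine le_antisymm h2 ?_
    by_contra! hlt
    have h3 : ∀ᶠ z in 𝓝 x, graphHeight e g z < 0 ∧ z ∈ Metric.ball p r :=
      (h.frame.continuous_graphHeight.continuousAt.eventually_lt_const hlt).and
        (Metric.isOpen_ball.mem_nhds hx)
    obtain ⟨z, hz, hzΩ⟩ := (h3.and_frequently (mem_closure_iff_frequently.1 h1)).exists
    exact absurd ((h.mem_iff z hz.2).1 hzΩ) hz.1.not_gt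
  · intro h0
    refine ⟨?_, h0.le⟩
    have hl : Tendsto (fun t : ℝ => x + t • e) (𝓝[>] 0) (𝓝 x) := by
      have : Tendsto (fun t : ℝ => x + t • e) (𝓝 0) (𝓝 (x + (0 : ℝ) • e)) :=
        Continuous.tendsto (by fun_prop) 0
      rw [zero_smul, add_zero] at this
      exact this.mono_left nhdsWithin_le_nhds
    refine mem_closure_of_tendsto hl ?_
    filter_upwards [hl (Metric.isOpen_ball.mem_nhds hx), self_mem_nhdsWithin] with t ht ht0
    rw [h.mem_iff _ ht, h.frame.graphHeight_add_smul, h0, zero_add]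
    exact ht0

lemma graphHeight_center (h : IsGraphChart Ω A e g K p r) : graphHeight e g p = 0 :=
  (h.mem_frontier_iff (Metric.mem_ball_self h.radius_pos)).1 h.mem_frontier

/-- The radius of a smaller ball, in which the points of `Ω` lie in the approach regions of the
boundary points below them. -/
noncomputable def innerRadius (K : NNReal) (r : ℝ) : ℝ := r / (2 * (2 + K))

lemma innerRadius_pos (h : IsGraphChart Ω A e g K p r) : 0 < innerRadius K r := by
  have := h.radius_pos
  unfold innerRadius
  positivity

/-- The factor `2 + K` is chosen so that a point of the small ball, of height at most `(1 + K) *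
innerRadius K r`, has its foot on the graph within `r / 2` of `p`. -/
lemma innerRadius_mul (K : NNReal) (r : ℝ) : (2 + K) * innerRadius K r = r / 2 := by
  unfold innerRadius
  field_simp

lemma two_mul_innerRadius_le (h : IsGraphChart Ω A e g K p r) : 4 * innerRadius K r ≤ r := by
  have h1 := innerRadius_mul K r
  have h2 := h.innerRadius_pos
  have : 0 ≤ K * innerRadius K r := by positivity
  nlinarith

lemma ball_innerRadius_subset (h : IsGraphChart Ω A e g K p r) :
    Metric.ball p (innerRadius K r) ⊆ Metric.ball p r :=
  Metric.ball_subset_ball (by linarith [h.two_mul_innerRadius_le, h.innerRadius_pos])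

lemma graphHeight_le (h : IsGraphChart Ω A e g K p r) {x : Space d}
    (hx : x ∈ Metric.ball p (innerRadius K r)) :
    graphHeight e g x ≤ (1 + K) * innerRadius K r := by
  have h1 := h.frame.abs_graphHeight_sub_le x p
  rw [h.graphHeight_center, sub_zero] at h1
  refine (le_abs_self _).trans (h1.trans ?_)
  gcongr
  rw [← dist_eq_norm]
  exact (Metric.mem_ball.1 hx).le

lemma graphPoint_mem_ball (h : IsGraphChart Ω A e g K p r) {y : Space (d - 1)} {t : ℝ} (ht : 0 ≤ t)
    (hx : graphPoint A e g y t ∈ Metric.ball p (innerRadius K r)) :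
    graphPoint A e g y 0 ∈ Metric.ball p r := by
  have h1 := h.graphHeight_le hx
  rw [h.frame.graphHeight_graphPoint] at h1
  rw [GraphFrame.graphPoint_eq_add, Metric.mem_ball, dist_eq_norm] at hx
  rw [Metric.mem_ball, dist_eq_norm]
  have h2 : ‖t • e‖ = t := by rw [norm_smul, h.frame.norm_eq_one, mul_one, Real.norm_of_nonneg ht]
  have h3 := norm_sub_le (graphPoint A e g y 0 + t • e - p) (t • e)
  have h4 : graphPoint A e g y 0 + t • e - p - t • e = graphPoint A e g y 0 - p := by abel
  rw [h4, h2] at h3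
  have := innerRadius_mul K r
  have := h.radius_pos
  linarith

/-- The foot is at distance `t`, while the height is `(1 + K)`-Lipschitz and vanishes on the
frontier near `p`, so the frontier is at distance at least `t / (1 + K)`. The aperture `2 + K`
leaves room for strict inequality. -/
lemma mem_approachRegion (h : IsGraphChart Ω A e g K p r) {y : Space (d - 1)} {t : ℝ} (ht : 0 < t)
    (hx : graphPoint A e g y t ∈ Metric.ball p (innerRadius K r)) :
    graphPoint A e g y t ∈ approachRegion Ω (2 + K) (graphPoint A e g y 0) := by
  set x := graphPoint A e g y t with hxdef
  have hh : graphHeight e g x = t := h.frame.graphHeight_graphPoint y t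
  have hxΩ : x ∈ Ω := (h.mem_iff x (h.ball_innerRadius_subset hx)).2 (by rw [hh]; exact ht)
  refine ⟨hxΩ, ?_⟩
  have h1 : ‖x - graphPoint A e g y 0‖ = t := by
    rw [hxdef, GraphFrame.graphPoint_eq_add, add_sub_cancel_left, norm_smul, h.frame.norm_eq_one,
      mul_one, Real.norm_of_nonneg ht.le]
  have hK : (0 : ℝ) < 1 + K := by positivity
  have h2 : t / (1 + K) ≤ Metric.infDist x (frontier Ω) := by
    refine (Metric.le_infDist ⟨p, h.mem_frontier⟩).2 fun s hs => ?_
    rw [div_le_iff₀ hK, mul_comm]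
    by_cases hsr : s ∈ Metric.ball p r
    · have h3 := h.frame.abs_graphHeight_sub_le x s
      rw [(h.mem_frontier_iff hsr).1 hs, hh, sub_zero, abs_of_pos ht] at h3
      rwa [dist_eq_norm]
    -- Frontier points outside the chart need not lie on the graph, but they are farther from `x`
    -- than `innerRadius K r`, and `t` is at most `1 + K` times that radius.
    · have h3 := h.graphHeight_le hx
      rw [hh] at h3
      refine h3.trans ?_
      gcongr
      rw [Metric.mem_ball, not_lt] at hsr
      have h4 := dist_triangle_left s p x
      have h5 := Metric.mem_ball.1 hx
      linarith [h.two_mul_innerRadius_le, h.innerRadius_pos]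
  rw [h1]
  calc t = (1 + K) * (t / (1 + K)) := by field_simp
    _ < (2 + K) * (t / (1 + K)) := by gcongr; norm_num
    _ ≤ _ := by gcongr

/-- The sign of the height decides membership in `Ω`, and `-graphNormal` is the gradient of the
height. Dividing by a norm that is at least 1 does not enlarge the first-order error. -/
lemma isOutwardNormal (h : IsGraphChart Ω A e g K p r) {y : Space (d - 1)}
    (hy : DifferentiableAt ℝ (fun z => g (A z)) y)
    (hyr : graphPoint A e g y 0 ∈ Metric.ball p r) :
    IsOutwardNormal Ω (graphPoint A e g y 0) (‖graphNormal A e g y‖⁻¹ • graphNormal A e g y) := by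
  have hN := h.frame.one_le_norm_graphNormal y
  have hN0 : 0 < ‖graphNormal A e g y‖ := by linarith
  refine ⟨by rw [norm_smul, norm_inv, norm_norm, inv_mul_cancel₀ hN0.ne'], fun ε hε => ?_⟩
  have h1 := (h.frame.hasFDerivAt_graphHeight hy 0).isLittleO.def hε
  filter_upwards [h1, Metric.isOpen_ball.mem_nhds hyr] with x hx hxr
  rw [h.frame.graphHeight_graphPoint, sub_zero, FunLike.coe_neg, Pi.neg_apply, innerSL_apply_apply,
    Real.norm_eq_abs, sub_neg_eq_add, abs_le] at hx
  have h2 : ‖graphNormal A e g y‖⁻¹ ≤ 1 := inv_le_one_of_one_le₀ hN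
  have h3 : 0 < ‖graphNormal A e g y‖⁻¹ := inv_pos.2 hN0
  have h4 : 0 ≤ ε * ‖x - graphPoint A e g y 0‖ := by positivity
  rw [inner_smul_left]
  simp only [conj_trivial]
  refine ⟨fun hxΩ => ?_, fun hxΩ => ?_⟩
  · have h5 := (h.mem_iff x hxr).1 hxΩ
    calc _ ≤ ‖graphNormal A e g y‖⁻¹ * (ε * ‖x - graphPoint A e g y 0‖) := by
          gcongr; linarith [hx.2]
      _ ≤ _ := mul_le_of_le_one_left h4 h2
  · have h5 := not_lt.1 (mt (h.mem_iff x hxr).2 hxΩ)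
    calc -(ε * ‖x - graphPoint A e g y 0‖)
        ≤ -(‖graphNormal A e g y‖⁻¹ * (ε * ‖x - graphPoint A e g y 0‖)) :=
          neg_le_neg (mul_le_of_le_one_left h4 h2)
      _ = ‖graphNormal A e g y‖⁻¹ * -(ε * ‖x - graphPoint A e g y 0‖) := by ring
      _ ≤ _ := by gcongr; linarith [hx.1]

lemma measurableEmbedding (h : IsGraphChart Ω A e g K p r) :
    MeasurableEmbedding fun y => graphPoint A e g y 0 :=
  (h.frame.isClosedEmbedding_graphPoint 0).measurableEmbedding

lemma surfaceMeasure_restrict_ball (h : IsGraphChart Ω A e g K p r) :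
    (surfaceMeasure Ω).restrict (Metric.ball p r) =
      ((volume.withDensity fun y => ENNReal.ofReal ‖graphNormal A e g y‖).map
        fun y => graphPoint A e g y 0).restrict (Metric.ball p r) := by
  have h1 := h.frame.restrict_euclideanHausdorffMeasure_range
  rw [finrank_euclideanSpace_fin] at h1
  rw [← h1, surfaceMeasure, Measure.restrict_restrict Metric.isOpen_ball.measurableSet,
    Measure.restrict_restrict Metric.isOpen_ball.measurableSet]
  congr 1
  ext x
  simp only [mem_inter_iff, and_congr_right_iff, mem_range]
  intro hx
  rw [h.mem_frontier_iff hx]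
  constructor
  · intro h0
    obtain ⟨y, hy⟩ := h.frame.exists_eq_graphPoint x
    exact ⟨y, by rw [hy, h0]⟩
  · rintro ⟨y, rfl⟩
    exact h.frame.graphHeight_graphPoint y 0

lemma measurable_density (A : Space (d - 1) →ₗᵢ[ℝ] Space d) (e : Space d) (g : Space d → ℝ) :
    Measurable fun y => ENNReal.ofReal ‖graphNormal A e g y‖ :=
  (GraphFrame.measurable_graphNormal A e g).norm.ennreal_ofReal

/-- The density of surface measure is at least 1, so null sets on the surface pull back to null
sets. -/
lemma ae_of_ae (h : IsGraphChart Ω A e g K p r) {P : Space d → Prop}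
    (hP : ∀ᵐ s ∂(surfaceMeasure Ω), P s) :
    ∀ᵐ y, graphPoint A e g y 0 ∈ Metric.ball p r → P (graphPoint A e g y 0) := by
  have h1 : ∀ᵐ s ∂((surfaceMeasure Ω).restrict (Metric.ball p r)), P s := ae_restrict_of_ae hP
  rw [h.surfaceMeasure_restrict_ball, ae_restrict_iff' Metric.isOpen_ball.measurableSet,
    h.measurableEmbedding.ae_map_iff, ae_withDensity_iff (measurable_density A e g)] at h1
  filter_upwards [h1] with y hy
  refine hy ?_
  rw [ne_eq, ENNReal.ofReal_eq_zero, not_le]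
  linarith [h.frame.one_le_norm_graphNormal y]

/-- The pullback of the maximal function of `F` to the hyperplane. -/
noncomputable def maximalPullback (Ω : Set (Space d)) (A : Space (d - 1) →ₗᵢ[ℝ] Space d) (e : Space d)
    (g : Space d → ℝ) (K : NNReal) (p : Space d) (r : ℝ) {V : Type*} [NormedAddCommGroup V]
    (F : Space d → V) (y : Space (d - 1)) : ENNReal :=
  (Metric.ball p r).indicator (maximalFunction Ω (2 + K) F) (graphPoint A e g y 0)

section

variable {V : Type*} [NormedAddCommGroup V] {F : Space d → V}

lemma measurable_maximalPullback (h : IsGraphChart Ω A e g K p r) (F : Space d → V) :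
    Measurable (maximalPullback Ω A e g K p r F) :=
  ((measurable_maximalFunction _ _).indicator Metric.isOpen_ball.measurableSet).comp
    h.measurableEmbedding.measurable

lemma lintegral_maximalPullback_ne_top (h : IsGraphChart Ω A e g K p r)
    (hF : ∫⁻ s, maximalFunction Ω (2 + K) F s ∂(surfaceMeasure Ω) < ⊤) :
    ∫⁻ y, maximalPullback Ω A e g K p r F y ≠ ⊤ := by
  have hm : Measurable ((Metric.ball p r).indicator (maximalFunction Ω (2 + K) F)) :=
    (measurable_maximalFunction _ _).indicator Metric.isOpen_ball.measurableSet
  refine ne_top_of_le_ne_top hF.ne ?_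
  calc ∫⁻ y, maximalPullback Ω A e g K p r F y
      ≤ ∫⁻ y, ENNReal.ofReal ‖graphNormal A e g y‖ * maximalPullback Ω A e g K p r F y := by
        refine lintegral_mono fun y => le_mul_of_one_le_left zero_le ?_
        rw [ENNReal.one_le_ofReal]
        exact h.frame.one_le_norm_graphNormal y
    _ = ∫⁻ s, (Metric.ball p r).indicator (maximalFunction Ω (2 + K) F) s
          ∂((volume.withDensity fun y => ENNReal.ofReal ‖graphNormal A e g y‖).map
            fun y => graphPoint A e g y 0) := by
        rw [h.measurableEmbedding.lintegral_map]
        exact (lintegral_withDensity_eq_lintegral_mul _ (measurable_density A e g)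
          (h.measurable_maximalPullback F)).symm
    _ = ∫⁻ s in Metric.ball p r, maximalFunction Ω (2 + K) F s ∂(surfaceMeasure Ω) := by
        rw [lintegral_indicator Metric.isOpen_ball.measurableSet, h.surfaceMeasure_restrict_ball]
    _ ≤ _ := setLIntegral_le_lintegral _ _

lemma enorm_le_maximalPullback (h : IsGraphChart Ω A e g K p r) {y : Space (d - 1)} {t : ℝ}
    (ht : 0 < t) (hx : graphPoint A e g y t ∈ Metric.ball p (innerRadius K r)) :
    ‖F (graphPoint A e g y t)‖ₑ ≤ maximalPullback Ω A e g K p r F y := by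
  rw [maximalPullback, indicator_of_mem (h.graphPoint_mem_ball ht.le hx)]
  exact enorm_le_maximalFunction (h.mem_approachRegion ht hx)

/-- Fubini along vertical lines: inside the ball, `Ω` occupies only heights in `(0, T]`, and there
`F` is bounded by the maximal function at the foot. -/
lemma integrableOn_ball (h : IsGraphChart Ω A e g K p r) (hFc : ContinuousOn F Ω)
    (hF : ∫⁻ s, maximalFunction Ω (2 + K) F s ∂(surfaceMeasure Ω) < ⊤) :
    IntegrableOn F (Ω ∩ Metric.ball p (innerRadius K r)) := by
  have hmeas : MeasurableSet (Ω ∩ Metric.ball p (innerRadius K r)) :=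
    (h.isOpen.inter Metric.isOpen_ball).measurableSet
  refine ⟨(hFc.mono inter_subset_left).aestronglyMeasurable hmeas, ?_⟩
  set T := (1 + K) * innerRadius K r
  have hle : ∀ q : Space (d - 1) × ℝ,
      (Ω ∩ Metric.ball p (innerRadius K r)).indicator (fun x => ‖F x‖ₑ)
        (graphPoint A e g q.1 q.2) ≤
      maximalPullback Ω A e g K p r F q.1 * (Ioc 0 T).indicator 1 q.2 := by
    rintro ⟨y, t⟩
    by_cases hx : graphPoint A e g y t ∈ Ω ∩ Metric.ball p (innerRadius K r)
    · have ht : 0 < t := by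
        have := (h.mem_iff _ (h.ball_innerRadius_subset hx.2)).1 hx.1
        rwa [h.frame.graphHeight_graphPoint] at this
      have ht' : t ≤ T := by
        have := h.graphHeight_le hx.2
        rwa [h.frame.graphHeight_graphPoint] at this
      rw [indicator_of_mem hx, indicator_of_mem (show t ∈ Ioc 0 T from ⟨ht, ht'⟩), Pi.one_apply, mul_one]
      exact h.enorm_le_maximalPullback ht hx.2
    · rw [indicator_of_notMem hx]
      exact zero_le
  rw [HasFiniteIntegral, ← lintegral_indicator hmeas,
    ← h.frame.measurePreserving_graphPoint.lintegral_comp_emb h.frame.measurableEmbedding_graphPoint]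
  refine (lintegral_mono hle).trans_lt ?_
  have h1 := lintegral_prod_mul (μ := (volume : Measure (Space (d - 1)))) (ν := (volume : Measure ℝ))
    (h.measurable_maximalPullback F).aemeasurable
    (Measurable.indicator (f := (1 : ℝ → ENNReal)) measurable_one (measurableSet_Ioc (a := 0) (b := T))).aemeasurable
  refine (h1.le).trans_lt (ENNReal.mul_lt_top (h.lintegral_maximalPullback_ne_top hF).lt_top ?_)
  rw [lintegral_indicator_one measurableSet_Ioc]
  exact measure_Ioc_lt_top

end

end IsGraphChart

end Chart


/-! ### The divergence theorem localized by a cutoff. -/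

section LocalDivergence

variable {d : ℕ}

lemma divergence_smul_eq_zero {χ : Space d → ℝ} {W : Space d → Space d} {x : Space d}
    (hx : x ∉ tsupport χ) : divergence (fun z => χ z • W z) x = 0 := by
  have : (fun z => χ z • W z) =ᶠ[𝓝 x] fun _ => 0 := by
    filter_upwards [(isClosed_tsupport χ).isOpen_compl.mem_nhds hx] with z hz
    rw [image_eq_zero_of_notMem_tsupport hz, zero_smul]
  rw [divergence_congr this, (hasFDerivAt_const _ _).divergence_eq]
  simp

namespace IsGraphChart

variable {Ω : Set (Space d)} {A : Space (d - 1) →ₗᵢ[ℝ] Space d} {e : Space d}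
  {g : Space d → ℝ} {K : NNReal} {p : Space d} {r : ℝ}

lemma integral_surface_eq (h : IsGraphChart Ω A e g K p r) {f : Space d → ℝ}
    (hf : ∀ x ∉ Metric.ball p r, f x = 0) :
    (Integrable f (surfaceMeasure Ω) ↔
      Integrable fun y => ‖graphNormal A e g y‖ * f (graphPoint A e g y 0)) ∧
    ∫ s, f s ∂(surfaceMeasure Ω) =
      ∫ y, ‖graphNormal A e g y‖ * f (graphPoint A e g y 0) := by
  have hs : Function.support f ⊆ Metric.ball p r := fun x hx => by
    by_contra hx'
    exact hx (hf x hx')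
  have hN : Measurable fun y => ‖graphNormal A e g y‖₊ :=
    (GraphFrame.measurable_graphNormal A e g).nnnorm
  have hd : (fun y => ENNReal.ofReal ‖graphNormal A e g y‖) =
      fun y => ((‖graphNormal A e g y‖₊ : NNReal) : ENNReal) := by
    ext y
    rw [ofReal_norm]
    rfl
  constructor
  · rw [← integrableOn_iff_integrable_of_support_subset hs, IntegrableOn,
      h.surfaceMeasure_restrict_ball, ← IntegrableOn,
      integrableOn_iff_integrable_of_support_subset hs, h.measurableEmbedding.integrable_map_iff, hd,
      integrable_withDensity_iff_integrable_smul hN]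
    exact Iff.rfl
  · rw [← setIntegral_eq_integral_of_forall_compl_eq_zero hf, h.surfaceMeasure_restrict_ball,
      setIntegral_eq_integral_of_forall_compl_eq_zero hf, h.measurableEmbedding.integral_map, hd,
      integral_withDensity_eq_integral_smul hN]
    rfl

/-- The divergence theorem for fields supported in a small ball around a boundary point. -/
theorem integral_divergence (h : IsGraphChart Ω A e g K p r) {W B : Space d → Space d}
    (hW : ContDiffOn ℝ 1 W Ω)
    (hmax : ∫⁻ s, maximalFunction Ω (2 + K) W s ∂(surfaceMeasure Ω) < ⊤)
    (hB : ∀ᵐ s ∂(surfaceMeasure Ω), HasBoundaryValue Ω W s (B s))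
    {χ : Space d → ℝ} (hχ : ContDiff ℝ 1 χ) (hχ1 : ∀ x, |χ x| ≤ 1)
    (hχs : tsupport χ ⊆ Metric.ball p (innerRadius K r))
    (hdiv : IntegrableOn (divergence fun x => χ x • W x) Ω) :
    Integrable (fun s => χ s * inner ℝ (normal Ω s) (B s)) (surfaceMeasure Ω) ∧
      ∫ x in Ω, divergence (fun x => χ x • W x) x =
        ∫ s, χ s * inner ℝ (normal Ω s) (B s) ∂(surfaceMeasure Ω) := by
  set U := {x | 0 < graphHeight e g x} with hU
  have hUo : IsOpen U := isOpen_lt continuous_const h.frame.continuous_graphHeight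
  have hχr : tsupport χ ⊆ Metric.ball p r := hχs.trans h.ball_innerRadius_subset
  have hχ0 : ∀ x ∉ Metric.ball p r, χ x = 0 := fun x hx =>
    image_eq_zero_of_notMem_tsupport fun hx' => hx (hχr hx')
  set D := divergence fun x => χ x • W x
  -- The set `Ω` and the epigraph `U` agree only near `p`. Extending by zero outside `Ω` is
  -- harmless: a point of `U` outside `Ω` is off the support of `χ`, so `F` is C¹ on all of `U`.
  set F : Space d → Space d := Ω.indicator fun x => χ x • W x with hFdef
  have hC : IsCompact (tsupport χ) :=
    Metric.isCompact_of_isClosed_isBounded (isClosed_tsupport χ) (Metric.isBounded_ball.subset hχs)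
  have hFC : ∀ x ∉ tsupport χ, F x = 0 := fun x hx => by
    rw [hFdef]
    by_cases hxΩ : x ∈ Ω
    · rw [indicator_of_mem hxΩ, image_eq_zero_of_notMem_tsupport hx, zero_smul]
    · rw [indicator_of_notMem hxΩ]
  have hFΩ : ∀ x ∈ Ω, F =ᶠ[𝓝 x] fun x => χ x • W x := fun x hx => by
    filter_upwards [h.isOpen.mem_nhds hx] with z hz
    rw [hFdef, indicator_of_mem hz]
  have hF0 : ∀ x ∉ tsupport χ, F =ᶠ[𝓝 x] fun _ => 0 := fun x hx => by
    filter_upwards [(isClosed_tsupport χ).isOpen_compl.mem_nhds hx] with z hz using hFC z hz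
  have hout : ∀ x ∈ U, x ∉ Ω → x ∉ tsupport χ := fun x hx hxΩ hxs =>
    hxΩ ((h.mem_iff x (hχr hxs)).2 hx)
  have hF : ContDiffOn ℝ 1 F U := by
    intro x hx
    by_cases hxΩ : x ∈ Ω
    · refine (ContDiffAt.congr_of_eventuallyEq ?_ (hFΩ x hxΩ)).contDiffWithinAt
      exact hχ.contDiffAt.smul (hW.contDiffAt (h.isOpen.mem_nhds hxΩ))
    · exact (contDiffAt_const.congr_of_eventuallyEq (hF0 x (hout x hx hxΩ))).contDiffWithinAt
  have hdivF : ∀ x ∈ U, divergence F x = Ω.indicator D x := by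
    intro x hx
    by_cases hxΩ : x ∈ Ω
    · rw [divergence_congr (hFΩ x hxΩ), indicator_of_mem hxΩ]
    · rw [divergence_congr (hF0 x (hout x hx hxΩ)), indicator_of_notMem hxΩ,
        (hasFDerivAt_const _ _).divergence_eq]
      simp
  have hDU : ∀ x ∈ Ω \ U, D x = 0 := fun x hx => divergence_smul_eq_zero fun hxs =>
    hx.2 ((h.mem_iff x (hχr hxs)).1 hx.1)
  have hdivFi : IntegrableOn (divergence F) U := by
    refine IntegrableOn.congr_fun ?_ (fun x hx => (hdivF x hx).symm) hUo.measurableSet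
    exact ((integrable_indicator_iff h.isOpen.measurableSet).2 hdiv).integrableOn
  have hint : ∫ x in U, divergence F x = ∫ x in Ω, D x := by
    rw [setIntegral_congr_fun hUo.measurableSet hdivF, setIntegral_indicator h.isOpen.measurableSet]
    exact (setIntegral_eq_of_subset_of_forall_sdiff_eq_zero h.isOpen.measurableSet
      inter_subset_right fun x hx => hDU x ⟨hx.1, fun hxU => hx.2 ⟨hxU, hx.1⟩⟩).symm
  have hdom : ∀ y t, 0 < t → ‖F (graphPoint A e g y t)‖ₑ ≤ maximalPullback Ω A e g K p r W y := by
    intro y t ht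
    by_cases hx : graphPoint A e g y t ∈ tsupport χ
    · refine le_trans ?_ (h.enorm_le_maximalPullback ht (hχs hx))
      have hxΩ : graphPoint A e g y t ∈ Ω := (h.mem_approachRegion ht (hχs hx)).1
      rw [hFdef, indicator_of_mem hxΩ, enorm_smul]
      refine mul_le_of_le_one_left zero_le ?_
      rw [← ofReal_norm, ENNReal.ofReal_le_one]
      exact hχ1 _
    · rw [hFC _ hx, enorm_zero]
      exact zero_le
  have hlim : ∀ᵐ y, Tendsto (fun t => F (graphPoint A e g y t)) (𝓝[>] 0)
      (𝓝 (χ (graphPoint A e g y 0) • B (graphPoint A e g y 0))) := by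
    filter_upwards [h.ae_of_ae hB] with y hy
    have hG : Tendsto (fun t => graphPoint A e g y t) (𝓝[>] 0) (𝓝 (graphPoint A e g y 0)) :=
      ((h.frame.continuous_graphPoint.comp (continuous_const.prodMk continuous_id)).tendsto
        0).mono_left nhdsWithin_le_nhds
    by_cases hx : graphPoint A e g y 0 ∈ tsupport χ
    · have hev : ∀ᶠ t in 𝓝[>] (0 : ℝ), graphPoint A e g y t ∈
          approachRegion Ω (2 + K) (graphPoint A e g y 0) := by
        filter_upwards [hG (Metric.isOpen_ball.mem_nhds (hχs hx)), self_mem_nhdsWithin] with t ht ht0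
        exact h.mem_approachRegion ht0 ht
      have h1 := (hy (hχr hx) (2 + K) (by linarith [K.coe_nonneg])).comp
        (tendsto_nhdsWithin_iff.2 ⟨hG, hev⟩)
      have h2 := ((hχ.continuous.tendsto _).comp hG).smul h1
      refine h2.congr' ?_
      filter_upwards [hev] with t ht
      rw [hFdef, indicator_of_mem ht.1]
      rfl
    · rw [image_eq_zero_of_notMem_tsupport hx, zero_smul]
      refine tendsto_const_nhds.congr' ?_
      filter_upwards [hG ((isClosed_tsupport χ).isOpen_compl.mem_nhds hx)] with t ht
      exact (hFC _ ht).symm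
  have hmain := h.frame.setIntegral_divergence hF hC hFC (h.measurable_maximalPullback W)
    (h.lintegral_maximalPullback_ne_top hmax) hdom hdivFi hlim
  -- The length of the unnormalized normal is exactly the density of surface measure, so normalizing
  -- the vector and passing to surface measure cancel.
  have hN : (fun y => (inner ℝ (graphNormal A e g y)
        (χ (graphPoint A e g y 0) • B (graphPoint A e g y 0)) : ℝ)) =ᵐ[volume]
      fun y => ‖graphNormal A e g y‖ * (χ (graphPoint A e g y 0) *
        inner ℝ (normal Ω (graphPoint A e g y 0)) (B (graphPoint A e g y 0))) := by
    filter_upwards [h.frame.lipschitz_comp.ae_differentiableAt] with y hy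
    by_cases hx : graphPoint A e g y 0 ∈ Metric.ball p r
    · have hn0 : ‖graphNormal A e g y‖ ≠ 0 := by linarith [h.frame.one_le_norm_graphNormal y]
      rw [(h.isOutwardNormal hy hx).normal_eq, inner_smul_left, inner_smul_right]
      simp only [conj_trivial]
      field_simp
    · rw [hχ0 _ hx]
      simp
  have hconv := h.integral_surface_eq (f := fun s => χ s * inner ℝ (normal Ω s) (B s))
    fun x hx => by rw [hχ0 x hx, zero_mul]
  refine ⟨hconv.1.2 (hmain.1.congr hN), ?_⟩
  rw [← hint, hmain.2, hconv.2]
  exact integral_congr_ae hN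

end IsGraphChart

/-- Serves the pieces of the partition of unity supported inside `Ω`. -/
lemma integral_divergence_of_hasCompactSupport {F : Space d → Space d} (hF : ContDiff ℝ 1 F)
    (hFc : HasCompactSupport F) : ∫ x, divergence F x = 0 := by
  set b := stdOrthonormalBasis ℝ (Space d)
  have hf : ∀ i, ContDiff ℝ 1 fun x => (inner ℝ (b i) (F x) : ℝ) := fun i =>
    contDiff_const.inner ℝ hF
  have hfc : ∀ i, HasCompactSupport fun x => (inner ℝ (b i) (F x) : ℝ) := fun i =>
    hFc.comp_left (g := fun v => (inner ℝ (b i) v : ℝ)) (inner_zero_right _)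
  have hd : ∀ x, divergence F x = ∑ i, fderiv ℝ (fun x => (inner ℝ (b i) (F x) : ℝ)) x (b i) := by
    intro x
    rw [divergence, LinearMap.trace_eq_sum_inner _ b]
    refine Finset.sum_congr rfl fun i _ => ?_
    rw [fderiv_inner_apply ℝ (differentiableAt_const _) (hF.differentiable one_ne_zero x)]
    simp
  simp_rw [hd]
  rw [integral_finsetSum _ fun i _ =>
    (GraphFrame.continuous_fderiv_apply_const (hf i) _).integrable_of_hasCompactSupport
      (GraphFrame.hasCompactSupport_fderiv_apply (hfc i) _)]
  refine Finset.sum_eq_zero fun i _ => ?_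
  obtain ⟨D, hD⟩ := (hf i).lipschitzWith_of_hasCompactSupport (hfc i) one_ne_zero
  have h0 := LipschitzWith.integral_lineDeriv_mul_eq (μ := (volume : Measure (Space d)))
    (LipschitzWith.const (1 : ℝ)) hD (hfc i) (-(b i))
  have hc0 : ∀ x : Space d, lineDeriv ℝ (fun _ : Space d => (1 : ℝ)) x (-(b i)) = 0 := fun x => by
    simp [lineDeriv]
  simp only [hc0, zero_mul, integral_zero, neg_neg, mul_one] at h0
  rw [h0]
  refine integral_congr_ae (ae_of_all _ fun x => ?_)
  exact (((hf i).differentiable one_ne_zero x).lineDeriv_eq_fderiv).symm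

end LocalDivergence

/-! ### The divergence theorem on a bounded Lipschitz domain. -/

section GlobalDivergence

variable {d : ℕ} {Ω : Set (Space d)}

lemma IsLipschitzDomain.isCompact_closure (hΩ : IsLipschitzDomain Ω) : IsCompact (closure Ω) :=
  hΩ.isBounded.isCompact_closure

lemma ae_mem_frontier : ∀ᵐ s ∂(surfaceMeasure Ω), s ∈ frontier Ω :=
  ae_restrict_mem isClosed_frontier.measurableSet

/-- A continuous function with integrable maximal function is integrable. -/
lemma IsLipschitzDomain.integrableOn_of_maximalFunction (hΩ : IsLipschitzDomain Ω) (hd : 1 ≤ d)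
    {V : Type*} [NormedAddCommGroup V] {F : Space d → V} (hF : ContinuousOn F Ω)
    (hmax : ∀ κ > 1, ∫⁻ s, maximalFunction Ω κ F s ∂(surfaceMeasure Ω) < ⊤) :
    IntegrableOn F Ω := by
  have key : IntegrableOn F (closure Ω) (volume.restrict Ω) := by
    refine LocallyIntegrableOn.integrableOn_isCompact (fun p hp => ?_) hΩ.isCompact_closure
    by_cases hpΩ : p ∈ Ω
    · obtain ⟨ε, hε, hεΩ⟩ := Metric.nhds_basis_closedBall.mem_iff.1 (hΩ.isOpen.mem_nhds hpΩ)
      refine ⟨Metric.closedBall p ε, mem_nhdsWithin_of_mem_nhds (Metric.closedBall_mem_nhds p hε), ?_⟩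
      have : IntegrableOn F (Metric.closedBall p ε) :=
        (hF.mono hεΩ).integrableOn_compact (isCompact_closedBall p ε)
      exact this.mono_measure Measure.restrict_le_self
    · have hpf : p ∈ frontier Ω := by
        rw [hΩ.isOpen.frontier_eq]; exact ⟨hp, hpΩ⟩
      obtain ⟨A, e, g, K, r, h⟩ := hΩ.exists_isGraphChart hd hpf
      refine ⟨Metric.ball p (IsGraphChart.innerRadius K r),
        mem_nhdsWithin_of_mem_nhds (Metric.ball_mem_nhds p h.innerRadius_pos), ?_⟩
      rw [IntegrableOn, Measure.restrict_restrict Metric.isOpen_ball.measurableSet, inter_comm]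
      exact h.integrableOn_ball hF (hmax _ (by linarith [K.coe_nonneg]))
  rwa [IntegrableOn, Measure.restrict_restrict isClosed_closure.measurableSet,
    inter_eq_right.2 subset_closure] at key

/-- The divergence theorem on a bounded Lipschitz domain. -/
theorem IsLipschitzDomain.integral_divergence (hΩ : IsLipschitzDomain Ω) (hd : 1 ≤ d)
    {W B : Space d → Space d} (hW : ContDiffOn ℝ 1 W Ω)
    (hmax : ∀ κ > 1, ∫⁻ s, maximalFunction Ω κ W s ∂(surfaceMeasure Ω) < ⊤)
    (hB : ∀ᵐ s ∂(surfaceMeasure Ω), HasBoundaryValue Ω W s (B s))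
    (hdiv : IntegrableOn (divergence W) Ω) :
    Integrable (fun s => (inner ℝ (normal Ω s) (B s) : ℝ)) (surfaceMeasure Ω) ∧
      ∫ x in Ω, divergence W x = ∫ s, inner ℝ (normal Ω s) (B s) ∂(surfaceMeasure Ω) := by
  have hWi : IntegrableOn W Ω := hΩ.integrableOn_of_maximalFunction hd hW.continuousOn hmax
  -- The product rule adds the term `fderiv ℝ χ x (W x)`, which is why `W` itself must be integrable
  -- on `Ω`.
  have hprod : ∀ χ : Space d → ℝ, ContDiff ℝ 1 χ → HasCompactSupport χ → (∀ x, |χ x| ≤ 1) →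
      IntegrableOn (divergence fun x => χ x • W x) Ω := by
    intro χ hχ hχc hχ1
    obtain ⟨D, hD⟩ := hχ.lipschitzWith_of_hasCompactSupport hχc one_ne_zero
    have h1 : IntegrableOn (fun x => χ x * divergence W x) Ω :=
      hdiv.bdd_mul (c := 1) hχ.continuous.aestronglyMeasurable (ae_of_all _ hχ1)
    have h2 : IntegrableOn (fun x => fderiv ℝ χ x (W x)) Ω := by
      refine (hWi.norm.const_mul (D : ℝ)).mono' ?_ (ae_of_all _ fun x => ?_)
      · exact ContinuousOn.aestronglyMeasurable
          ((hχ.continuous_fderiv one_ne_zero).continuousOn.clm_apply hW.continuousOn)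
          hΩ.isOpen.measurableSet
      · exact (ContinuousLinearMap.le_opNorm _ _).trans
          (by gcongr; exact norm_fderiv_le_of_lipschitz ℝ hD)
    refine (h1.add h2).congr_fun (fun x hx => ?_) hΩ.isOpen.measurableSet
    exact (divergence_smul (hχ.differentiable one_ne_zero x)
      ((hW.contDiffAt (hΩ.isOpen.mem_nhds hx)).differentiableAt one_ne_zero)).symm
  have hloc : ∀ p ∈ closure Ω, ∃ ρ > 0, ∀ χ : Space d → ℝ, ContDiff ℝ 1 χ → (∀ x, |χ x| ≤ 1) →
      tsupport χ ⊆ Metric.ball p ρ →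
      IntegrableOn (divergence fun x => χ x • W x) Ω ∧
      Integrable (fun s => χ s * inner ℝ (normal Ω s) (B s)) (surfaceMeasure Ω) ∧
      ∫ x in Ω, divergence (fun x => χ x • W x) x =
        ∫ s, χ s * inner ℝ (normal Ω s) (B s) ∂(surfaceMeasure Ω) := by
    intro p hp
    by_cases hpΩ : p ∈ Ω
    · obtain ⟨ρ, hρ, hρΩ⟩ := Metric.isOpen_iff.1 hΩ.isOpen p hpΩ
      refine ⟨ρ, hρ, fun χ hχ hχ1 hχs => ?_⟩
      have hχc : HasCompactSupport χ := Metric.isCompact_of_isClosed_isBounded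
        (isClosed_tsupport χ) (Metric.isBounded_ball.subset hχs)
      have hsm : ContDiff ℝ 1 fun x => χ x • W x :=
        contDiff_smul_of_tsupport_subset hΩ.isOpen hχ (hχs.trans hρΩ) hW
      have h0 : (fun s => χ s * inner ℝ (normal Ω s) (B s)) =ᵐ[surfaceMeasure Ω] fun _ => (0 : ℝ) := by
        filter_upwards [ae_mem_frontier (Ω := Ω)] with s hs
        rw [hΩ.isOpen.frontier_eq] at hs
        rw [image_eq_zero_of_notMem_tsupport fun h => hs.2 (hρΩ (hχs h)), zero_mul]
      refine ⟨hprod χ hχ hχc hχ1, (integrable_zero _ _ _).congr h0.symm, ?_⟩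
      rw [integral_congr_ae h0, integral_zero, setIntegral_eq_integral_of_forall_compl_eq_zero]
      · exact integral_divergence_of_hasCompactSupport hsm (hχc.smul_right)
      · exact fun x hx => divergence_smul_eq_zero fun h => hx (hρΩ (hχs h))
    · have hpf : p ∈ frontier Ω := by
        rw [hΩ.isOpen.frontier_eq]; exact ⟨hp, hpΩ⟩
      obtain ⟨A, e, g, K, r, h⟩ := hΩ.exists_isGraphChart hd hpf
      refine ⟨_, h.innerRadius_pos, fun χ hχ hχ1 hχs => ?_⟩
      have hχc : HasCompactSupport χ := Metric.isCompact_of_isClosed_isBounded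
        (isClosed_tsupport χ) (Metric.isBounded_ball.subset hχs)
      exact ⟨hprod χ hχ hχc hχ1, h.integral_divergence hW (hmax _ (by linarith [K.coe_nonneg])) hB hχ hχ1 hχs
        (hprod χ hχ hχc hχ1)⟩
  choose! ρ hρ hloc using hloc
  obtain ⟨T, hTsub, hTcov⟩ := hΩ.isCompact_closure.elim_nhds_subcover
    (fun p => Metric.ball p (ρ p)) fun p hp => Metric.ball_mem_nhds p (hρ p hp)
  obtain ⟨f, hf⟩ := SmoothPartitionOfUnity.exists_isSubordinate (modelWithCornersSelf ℝ (Space d))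
    (isClosed_closure (s := Ω)) (fun p : T => Metric.ball (p : Space d) (ρ p))
    (fun p => Metric.isOpen_ball) (hTcov.trans (by
      intro x hx
      obtain ⟨p, hp, hxp⟩ := mem_iUnion₂.1 hx
      exact mem_iUnion.2 ⟨⟨p, hp⟩, hxp⟩))
  have hsum : ∀ x ∈ closure Ω, ∑ p, f p x = 1 := fun x hx => by
    rw [← finsum_eq_sum_of_fintype]; exact f.sum_eq_one hx
  have hfc : ∀ p, ContDiff ℝ 1 (f p) := fun p => ((f p).contMDiff.contDiff).of_le (by simp)
  have hall := fun p : T => hloc p (hTsub p p.2) (f p) (hfc p)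
    (fun x => by rw [abs_of_nonneg (f.nonneg p x)]; exact f.le_one p x) (hf p)
  have hbdry : (fun s => (inner ℝ (normal Ω s) (B s) : ℝ)) =ᵐ[surfaceMeasure Ω]
      fun s => ∑ p, f p s * inner ℝ (normal Ω s) (B s) := by
    filter_upwards [ae_mem_frontier (Ω := Ω)] with s hs
    rw [← Finset.sum_mul, hsum s (frontier_subset_closure hs), one_mul]
  -- The partition sums to 1 on a neighbourhood of each point of the open set `Ω`, so the
  -- derivatives of the cutoffs cancel in the sum.
  have hdivs : ∀ x ∈ Ω, divergence W x = ∑ p, divergence (fun z => f p z • W z) x := by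
    intro x hx
    have hWx : DifferentiableAt ℝ W x :=
      (hW.contDiffAt (hΩ.isOpen.mem_nhds hx)).differentiableAt one_ne_zero
    refine Eq.trans (divergence_congr ?_)
      (divergence_sum fun p _ => ((hfc p).differentiable one_ne_zero x).smul hWx)
    filter_upwards [hΩ.isOpen.mem_nhds hx] with z hz
    rw [← Finset.sum_smul, hsum z (subset_closure hz), one_smul]
  refine ⟨(integrable_finsetSum _ fun p _ => (hall p).2.1).congr hbdry.symm, ?_⟩
  rw [integral_congr_ae hbdry, setIntegral_congr_fun hΩ.isOpen.measurableSet hdivs,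
    integral_finsetSum _ fun p _ => (hall p).1, integral_finsetSum _ fun p _ => (hall p).2.1]
  exact Finset.sum_congr rfl fun p _ => (hall p).2.2

end GlobalDivergence


/-! ### Gradient, Hessian and Laplacian. -/

section Gradient

variable {d : ℕ} {u : Space d → ℝ} {x : Space d}

lemma inner_gradient (u : Space d → ℝ) (x w : Space d) :
    inner ℝ (gradient u x) w = fderiv ℝ u x w := by
  rw [gradient, InnerProductSpace.toDual_symm_apply]

lemma gradient_eq_sum (u : Space d → ℝ) (x : Space d) :
    gradient u x = ∑ i, fderiv ℝ u x (stdOrthonormalBasis ℝ (Space d) i) •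
      stdOrthonormalBasis ℝ (Space d) i := by
  conv_lhs => rw [← (stdOrthonormalBasis ℝ (Space d)).sum_repr' (gradient u x)]
  refine Finset.sum_congr rfl fun i _ => ?_
  rw [real_inner_comm, inner_gradient]

lemma contDiffOn_gradient {Ω : Set (Space d)} (hΩ : IsOpen Ω) (hu : ContDiffOn ℝ 2 u Ω) :
    ContDiffOn ℝ 1 (gradient u) Ω := by
  have h1 : ContDiffOn ℝ 1 (fderiv ℝ u) Ω := hu.fderiv_of_isOpen hΩ (by norm_num)
  have h2 : gradient u = fun x => ∑ i, fderiv ℝ u x (stdOrthonormalBasis ℝ (Space d) i) •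
      stdOrthonormalBasis ℝ (Space d) i := funext (gradient_eq_sum u)
  rw [h2]
  exact ContDiffOn.sum fun i _ => (h1.clm_apply contDiffOn_const).smul contDiffOn_const

lemma differentiableAt_gradient (hu : ContDiffAt ℝ 2 u x) : DifferentiableAt ℝ (gradient u) x := by
  have h1 : DifferentiableAt ℝ (fderiv ℝ u) x :=
    (hu.fderiv_right (m := 1) (by norm_num)).differentiableAt one_ne_zero
  have h2 : gradient u = fun x => ∑ i, fderiv ℝ u x (stdOrthonormalBasis ℝ (Space d) i) •
      stdOrthonormalBasis ℝ (Space d) i := funext (gradient_eq_sum u)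
  rw [h2]
  exact DifferentiableAt.fun_sum fun i _ =>
    (h1.clm_apply (differentiableAt_const _)).smul (differentiableAt_const _)

lemma inner_fderiv_gradient (hu : ContDiffAt ℝ 2 u x) (z w : Space d) :
    inner ℝ (fderiv ℝ (gradient u) x z) w = fderiv ℝ (fderiv ℝ u) x z w := by
  have h1 : DifferentiableAt ℝ (fderiv ℝ u) x :=
    (hu.fderiv_right (m := 1) (by norm_num)).differentiableAt one_ne_zero
  have h2 : (fun y => (inner ℝ (gradient u y) w : ℝ)) = fun y => fderiv ℝ u y w :=
    funext fun y => inner_gradient u y w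
  have h3 : fderiv ℝ (fun y => (inner ℝ (gradient u y) w : ℝ)) x z =
      fderiv ℝ (fun y => fderiv ℝ u y w) x z := by rw [h2]
  rw [fderiv_inner_apply ℝ (differentiableAt_gradient hu) (differentiableAt_const w),
    fderiv_clm_apply h1 (differentiableAt_const w)] at h3
  simpa using h3

/-- Symmetry of the Hessian; it cancels the second-order terms in the divergence of the Rellich
field. -/
lemma inner_fderiv_gradient_comm (hu : ContDiffAt ℝ 2 u x) (z w : Space d) :
    inner ℝ (fderiv ℝ (gradient u) x z) w = inner ℝ (fderiv ℝ (gradient u) x w) z := by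
  rw [inner_fderiv_gradient hu, inner_fderiv_gradient hu]
  exact hu.isSymmSndFDerivAt (by simp) z w

lemma divergence_gradient (hu : ContDiffAt ℝ 2 u x) :
    divergence (gradient u) x = Laplacian.laplacian u x := by
  rw [divergence, LinearMap.trace_eq_sum_inner _ (stdOrthonormalBasis ℝ (Space d)),
    InnerProductSpace.laplacian_eq_iteratedFDeriv_stdOrthonormalBasis]
  refine Finset.sum_congr rfl fun i _ => ?_
  rw [iteratedFDeriv_two_apply, real_inner_comm, ContinuousLinearMap.coe_coe, inner_fderiv_gradient hu]
  simp

end Gradient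

/-! ### The two vector fields and their divergences. -/

section Fields

variable {d : ℕ} {Ω ΓD : Set (Space d)} {γ : Space d → ℝ}

/-- All fields used are quadratic in the functions and their gradients, so square integrable maximal
functions of these yield an integrable maximal function of the field. -/
lemma lintegral_maximalFunction_lt_top_of_le {V : Type*} [NormedAddCommGroup V]
    {W : Space d → V} {u v : Space d → ℝ} {G G' : Space d → Space d}
    (hu : RegularUpToBoundary Ω u) (hv : RegularUpToBoundary Ω v)
    (hG : RegularUpToBoundary Ω G) (hG' : RegularUpToBoundary Ω G') {C : ℝ}
    (hW : ∀ x ∈ Ω, ‖W x‖ ≤ C * (‖u x‖ ^ 2 + ‖v x‖ ^ 2 + ‖G x‖ ^ 2 + ‖G' x‖ ^ 2))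
    {κ : ℝ} (hκ : 1 < κ) : ∫⁻ s, maximalFunction Ω κ W s ∂(surfaceMeasure Ω) < ⊤ := by
  have hm : ∀ {V : Type} [NormedAddCommGroup V] (f : Space d → V),
      Measurable fun s => maximalFunction Ω κ f s ^ 2 := fun f =>
    (measurable_maximalFunction κ f).pow_const 2
  have hle : ∀ s, maximalFunction Ω κ W s ≤ ENNReal.ofReal C *
      (maximalFunction Ω κ u s ^ 2 + maximalFunction Ω κ v s ^ 2 + maximalFunction Ω κ G s ^ 2 +
        maximalFunction Ω κ G' s ^ 2) := by
    intro s
    refine iSup₂_le fun x hx => ?_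
    have h1 : ‖W x‖ₑ ≤ ENNReal.ofReal C * (‖u x‖ₑ ^ 2 + ‖v x‖ₑ ^ 2 + ‖G x‖ₑ ^ 2 + ‖G' x‖ₑ ^ 2) := by
      rw [← ofReal_norm, ← ofReal_norm, ← ofReal_norm, ← ofReal_norm, ← ofReal_norm,
        ← ENNReal.ofReal_pow (norm_nonneg _), ← ENNReal.ofReal_pow (norm_nonneg _),
        ← ENNReal.ofReal_pow (norm_nonneg _), ← ENNReal.ofReal_pow (norm_nonneg _),
        ← ENNReal.ofReal_add (by positivity) (by positivity),
        ← ENNReal.ofReal_add (by positivity) (by positivity),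
        ← ENNReal.ofReal_add (by positivity) (by positivity),
        ← ENNReal.ofReal_mul' (by positivity)]
      exact ENNReal.ofReal_le_ofReal (hW x hx.1)
    refine h1.trans ?_
    gcongr <;> exact enorm_le_maximalFunction hx
  refine (lintegral_mono hle).trans_lt ?_
  rw [lintegral_const_mul' _ _ ENNReal.ofReal_ne_top, lintegral_add_right _ (hm G'),
    lintegral_add_right _ (hm G), lintegral_add_right _ (hm v)]
  exact ENNReal.mul_lt_top ENNReal.ofReal_lt_top (ENNReal.add_lt_top.2 ⟨ENNReal.add_lt_top.2
    ⟨ENNReal.add_lt_top.2 ⟨hu.maximalFunction_sq κ hκ, hv.maximalFunction_sq κ hκ⟩,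
      hG.maximalFunction_sq κ hκ⟩, hG'.maximalFunction_sq κ hκ⟩)

lemma mul_le_sum_sq (p q α β : ℝ) :
    p * q ≤ p ^ 2 + q ^ 2 + α ^ 2 + β ^ 2 ∧ p * α ≤ p ^ 2 + q ^ 2 + α ^ 2 + β ^ 2 ∧
    p * β ≤ p ^ 2 + q ^ 2 + α ^ 2 + β ^ 2 ∧ q * α ≤ p ^ 2 + q ^ 2 + α ^ 2 + β ^ 2 ∧
    q * β ≤ p ^ 2 + q ^ 2 + α ^ 2 + β ^ 2 ∧ α * β ≤ p ^ 2 + q ^ 2 + α ^ 2 + β ^ 2 := by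
  refine ⟨?_, ?_, ?_, ?_, ?_, ?_⟩ <;>
  nlinarith [sq_nonneg (p - q), sq_nonneg (p - α), sq_nonneg (p - β), sq_nonneg (q - α),
    sq_nonneg (q - β), sq_nonneg (α - β), sq_nonneg p, sq_nonneg q, sq_nonneg α, sq_nonneg β]

namespace IsEigenfunction

variable {u v : Space d → ℝ} {E E' : ℝ}

lemma contDiffAt (hu : IsEigenfunction Ω ΓD γ E u) (hΩ : IsOpen Ω) {x : Space d} (hx : x ∈ Ω) :
    ContDiffAt ℝ 2 u x := hu.contDiffOn.contDiffAt (hΩ.mem_nhds hx)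

lemma differentiableAt (hu : IsEigenfunction Ω ΓD γ E u) (hΩ : IsOpen Ω) {x : Space d} (hx : x ∈ Ω) :
    DifferentiableAt ℝ u x := (hu.contDiffAt hΩ hx).differentiableAt two_ne_zero

lemma divergence_gradient_eq (hu : IsEigenfunction Ω ΓD γ E u) (hΩ : IsOpen Ω) {x : Space d}
    (hx : x ∈ Ω) : divergence (gradient u) x = -(E * u x) := by
  rw [divergence_gradient (hu.contDiffAt hΩ hx), ← hu.helmholtz x hx, neg_neg]

lemma ae_hasBoundaryValue (hu : IsEigenfunction Ω ΓD γ E u) :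
    ∀ᵐ s ∂(surfaceMeasure Ω), HasBoundaryValue Ω u s (trace Ω u s) ∧
      HasBoundaryValue Ω (gradient u) s (gradTrace Ω u s) := by
  filter_upwards [hu.regular.exists_boundaryValue, hu.regular_gradient.exists_boundaryValue]
    with s h1 h2 using ⟨hasBoundaryValue_boundaryValue h1, hasBoundaryValue_boundaryValue h2⟩

/-- The vector field whose flux through the boundary is the form `q`. -/
noncomputable def rellichField (a : Space d) (u v : Space d → ℝ) (ℰ : ℝ) (x : Space d) : Space d :=
  (((d : ℝ) - 2) / 2 * v x + inner ℝ (x - a) (gradient v x)) • gradient u x +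
    (((d : ℝ) - 2) / 2 * u x + inner ℝ (x - a) (gradient u x)) • gradient v x +
    (ℰ / 2 * (u x * v x) - inner ℝ (gradient u x) (gradient v x)) • (x - a)

/-- The vector field `|x - a|² / 2 (v ∇u - u ∇v)`. -/
noncomputable def momentField (a : Space d) (u v : Space d → ℝ) (x : Space d) : Space d :=
  (‖x - a‖ ^ 2 / 2 * v x) • gradient u x - (‖x - a‖ ^ 2 / 2 * u x) • gradient v x

/-- The first-order commutator `r · (v ∇u - u ∇v)`. -/
noncomputable def radialCommutator (a : Space d) (u v : Space d → ℝ) (x : Space d) : ℝ :=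
  v x * inner ℝ (x - a) (gradient u x) - u x * inner ℝ (x - a) (gradient v x)

lemma hasFDerivAt_normSq (a x : Space d) :
    HasFDerivAt (fun y => ‖y - a‖ ^ 2 / 2) (innerSL ℝ (x - a)) x := by
  have h1 := ((hasFDerivAt_id x).sub_const a).norm_sq
  have h2 := h1.mul_const (1 / 2 : ℝ)
  refine (h2.congr_fderiv ?_).congr_of_eventuallyEq (Eventually.of_forall fun y => by simp; ring)
  ext w
  simp

/-- The derivative of ∇u·∇v along `x - a` cancels the Hessian terms of the first two summands, and
the coefficient of ∇u·∇v is 2((d-2)/2 + 1) - d = 0. The equations replace the Laplacians; the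
average of `E` and `E'` in the third summand leaves the antisymmetric first-order term. -/
lemma divergence_rellichField (hΩ : IsOpen Ω) (hu : IsEigenfunction Ω ΓD γ E u)
    (hv : IsEigenfunction Ω ΓD γ E' v) (a : Space d) {x : Space d} (hx : x ∈ Ω) :
    divergence (rellichField a u v (E + E')) x =
      (E + E') * (u x * v x) + (E - E') / 2 * radialCommutator a u v x := by
  have hu2 := hu.contDiffAt hΩ hx
  have hv2 := hv.contDiffAt hΩ hx
  have hud := hu.differentiableAt hΩ hx
  have hvd := hv.differentiableAt hΩ hx
  have hgu := differentiableAt_gradient hu2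
  have hgv := differentiableAt_gradient hv2
  have hr : DifferentiableAt ℝ (fun y : Space d => y - a) x := differentiableAt_id.sub_const a
  have hru : DifferentiableAt ℝ (fun y => (inner ℝ (y - a) (gradient u y) : ℝ)) x := hr.inner ℝ hgu
  have hrv : DifferentiableAt ℝ (fun y => (inner ℝ (y - a) (gradient v y) : ℝ)) x := hr.inner ℝ hgv
  have hguv : DifferentiableAt ℝ (fun y => (inner ℝ (gradient u y) (gradient v y) : ℝ)) x :=
    hgu.inner ℝ hgv
  have hdr : fderiv ℝ (fun y : Space d => y - a) x = ContinuousLinearMap.id ℝ _ := by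
    rw [fderiv_sub_const, fderiv_fun_id]
  have hdivr : divergence (fun y : Space d => y - a) x = d := by
    rw [divergence, hdr]
    simp
  have e1 : fderiv ℝ (fun y => ((d : ℝ) - 2) / 2 * v y + inner ℝ (y - a) (gradient v y)) x
      (gradient u x) = ((d : ℝ) - 2) / 2 * inner ℝ (gradient v x) (gradient u x) +
        (inner ℝ (gradient u x) (gradient v x) +
          inner ℝ (x - a) (fderiv ℝ (gradient v) x (gradient u x))) := by
    rw [fderiv_fun_add (hvd.const_mul _) hrv, fderiv_const_mul hvd, FunLike.coe_add, Pi.add_apply,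
      FunLike.coe_smul, Pi.smul_apply, fderiv_inner_apply ℝ hr hgv, hdr, ← inner_gradient,
      smul_eq_mul]
    simp only [ContinuousLinearMap.id_apply]
    ring
  have e2 : fderiv ℝ (fun y => ((d : ℝ) - 2) / 2 * u y + inner ℝ (y - a) (gradient u y)) x
      (gradient v x) = ((d : ℝ) - 2) / 2 * inner ℝ (gradient u x) (gradient v x) +
        (inner ℝ (gradient v x) (gradient u x) +
          inner ℝ (x - a) (fderiv ℝ (gradient u) x (gradient v x))) := by
    rw [fderiv_fun_add (hud.const_mul _) hru, fderiv_const_mul hud, FunLike.coe_add, Pi.add_apply,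
      FunLike.coe_smul, Pi.smul_apply, fderiv_inner_apply ℝ hr hgu, hdr, ← inner_gradient,
      smul_eq_mul]
    simp only [ContinuousLinearMap.id_apply]
    ring
  have e3 : fderiv ℝ (fun y => (E + E') / 2 * (u y * v y) - inner ℝ (gradient u y) (gradient v y)) x
      (x - a) = (E + E') / 2 * (u x * inner ℝ (gradient v x) (x - a) +
        v x * inner ℝ (gradient u x) (x - a)) -
        (inner ℝ (fderiv ℝ (gradient u) x (x - a)) (gradient v x) +
          inner ℝ (gradient u x) (fderiv ℝ (gradient v) x (x - a))) := by
    rw [fderiv_fun_sub ((hud.fun_mul hvd).const_mul _) hguv, fderiv_const_mul (hud.fun_mul hvd),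
      fderiv_fun_mul hud hvd,
      FunLike.coe_sub, Pi.sub_apply, fderiv_inner_apply ℝ hgu hgv]
    simp only [FunLike.coe_smul, Pi.smul_apply, FunLike.coe_add, Pi.add_apply, ← inner_gradient,
      smul_eq_mul]
    ring
  have d1 : DifferentiableAt ℝ
      (fun y => ((d : ℝ) - 2) / 2 * v y + inner ℝ (y - a) (gradient v y)) x :=
    (hvd.const_mul _).add hrv
  have d2 : DifferentiableAt ℝ
      (fun y => ((d : ℝ) - 2) / 2 * u y + inner ℝ (y - a) (gradient u y)) x :=
    (hud.const_mul _).add hru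
  have d3 : DifferentiableAt ℝ
      (fun y => (E + E') / 2 * (u y * v y) - inner ℝ (gradient u y) (gradient v y)) x :=
    ((hud.mul hvd).const_mul _).sub hguv
  unfold rellichField radialCommutator
  rw [divergence_add ((d1.fun_smul hgu).fun_add (d2.fun_smul hgv)) (d3.fun_smul hr),
    divergence_add (d1.fun_smul hgu) (d2.fun_smul hgv), divergence_smul d1 hgu, divergence_smul d2 hgv,
    divergence_smul d3 hr, e1, e2, e3, hdivr, hu.divergence_gradient_eq hΩ hx,
    hv.divergence_gradient_eq hΩ hx]
  have s1 : inner ℝ (x - a) (fderiv ℝ (gradient v) x (gradient u x)) =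
      inner ℝ (gradient u x) (fderiv ℝ (gradient v) x (x - a)) := by
    rw [real_inner_comm, inner_fderiv_gradient_comm hv2, real_inner_comm]
  have s2 : inner ℝ (x - a) (fderiv ℝ (gradient u) x (gradient v x)) =
      inner ℝ (fderiv ℝ (gradient u) x (x - a)) (gradient v x) := by
    rw [real_inner_comm, inner_fderiv_gradient_comm hu2]
  rw [s1, s2, real_inner_comm (gradient u x) (gradient v x), real_inner_comm (gradient v x) (x - a),
    real_inner_comm (gradient u x) (x - a)]
  ring

/-- The gradient of the weight ‖x - a‖²/2 is `x - a`, which produces the commutator, and the ∇u·∇v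
terms of the two summands cancel. -/
lemma divergence_momentField (hΩ : IsOpen Ω) (hu : IsEigenfunction Ω ΓD γ E u)
    (hv : IsEigenfunction Ω ΓD γ E' v) (a : Space d) {x : Space d} (hx : x ∈ Ω) :
    divergence (momentField a u v) x =
      radialCommutator a u v x - (E - E') / 2 * (‖x - a‖ ^ 2 * (u x * v x)) := by
  have hud := hu.differentiableAt hΩ hx
  have hvd := hv.differentiableAt hΩ hx
  have hgu := differentiableAt_gradient (hu.contDiffAt hΩ hx)
  have hgv := differentiableAt_gradient (hv.contDiffAt hΩ hx)
  have hn := hasFDerivAt_normSq a x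
  have h1 := hn.fun_mul hvd.hasFDerivAt
  have h2 := hn.fun_mul hud.hasFDerivAt
  unfold momentField radialCommutator
  rw [divergence_sub (h1.differentiableAt.fun_smul hgu) (h2.differentiableAt.fun_smul hgv),
    divergence_smul h1.differentiableAt hgu, divergence_smul h2.differentiableAt hgv,
    h1.fderiv, h2.fderiv, hu.divergence_gradient_eq hΩ hx, hv.divergence_gradient_eq hΩ hx]
  simp only [FunLike.coe_smul, Pi.smul_apply, FunLike.coe_add, Pi.add_apply, ← inner_gradient,
    smul_eq_mul, innerSL_apply_apply]
  rw [real_inner_comm (gradient u x) (gradient v x)]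
  ring

end IsEigenfunction

end Fields


/-! ### Boundary form in terms of interior integrals, and the resulting bound. -/

section QuadraticIdentity

variable {d : ℕ} {Ω ΓD : Set (Space d)} {γ : Space d → ℝ}

namespace IsEigenfunction

variable {u v : Space d → ℝ} {E E' : ℝ}

lemma norm_rellichField_le (a : Space d) (u v : Space d → ℝ) (ℰ : ℝ) {x : Space d} {R : ℝ}
    (hR : ‖x - a‖ ≤ R) : ‖rellichField a u v ℰ x‖ ≤
      (2 * |((d : ℝ) - 2) / 2| + 3 * R + |ℰ / 2| * R) *
        (‖u x‖ ^ 2 + ‖v x‖ ^ 2 + ‖gradient u x‖ ^ 2 + ‖gradient v x‖ ^ 2) := by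
  have hR0 : 0 ≤ R := (norm_nonneg _).trans hR
  obtain ⟨hpq, -, hpβ, hqα, -, hαβ⟩ := mul_le_sum_sq ‖u x‖ ‖v x‖ ‖gradient u x‖ ‖gradient v x‖
  set S := ‖u x‖ ^ 2 + ‖v x‖ ^ 2 + ‖gradient u x‖ ^ 2 + ‖gradient v x‖ ^ 2
  set c := ((d : ℝ) - 2) / 2
  have hin : ∀ w : Space d, ‖(inner ℝ (x - a) w : ℝ)‖ ≤ R * ‖w‖ := fun w =>
    (norm_inner_le_norm _ _).trans (by gcongr)
  have h1 : ‖(c * v x + inner ℝ (x - a) (gradient v x)) • gradient u x‖ ≤ |c| * S + R * S := by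
    rw [norm_smul]
    calc _ ≤ (|c| * ‖v x‖ + R * ‖gradient v x‖) * ‖gradient u x‖ := by
          gcongr
          refine (norm_add_le _ _).trans (add_le_add ?_ (hin _))
          rw [norm_mul, Real.norm_eq_abs c]
      _ = |c| * (‖v x‖ * ‖gradient u x‖) + R * (‖gradient u x‖ * ‖gradient v x‖) := by ring
      _ ≤ _ := by gcongr
  have h2 : ‖(c * u x + inner ℝ (x - a) (gradient u x)) • gradient v x‖ ≤ |c| * S + R * S := by
    rw [norm_smul]
    calc _ ≤ (|c| * ‖u x‖ + R * ‖gradient u x‖) * ‖gradient v x‖ := by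
          gcongr
          refine (norm_add_le _ _).trans (add_le_add ?_ (hin _))
          rw [norm_mul, Real.norm_eq_abs c]
      _ = |c| * (‖u x‖ * ‖gradient v x‖) + R * (‖gradient u x‖ * ‖gradient v x‖) := by ring
      _ ≤ _ := by gcongr
  have h3 : ‖(ℰ / 2 * (u x * v x) - inner ℝ (gradient u x) (gradient v x)) • (x - a)‖ ≤
      (|ℰ / 2| * S + S) * R := by
    rw [norm_smul]
    gcongr
    refine (norm_sub_le _ _).trans (add_le_add ?_ ((norm_inner_le_norm _ _).trans hαβ))
    rw [norm_mul, norm_mul, Real.norm_eq_abs (ℰ / 2)]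
    gcongr
  calc _ ≤ (|c| * S + R * S) + (|c| * S + R * S) + (|ℰ / 2| * S + S) * R :=
        (norm_add_le _ _).trans (add_le_add ((norm_add_le _ _).trans (add_le_add h1 h2)) h3)
    _ = _ := by ring

lemma norm_momentField_le (a : Space d) (u v : Space d → ℝ) {x : Space d} {R : ℝ}
    (hR : ‖x - a‖ ≤ R) : ‖momentField a u v x‖ ≤ R ^ 2 *
      (‖u x‖ ^ 2 + ‖v x‖ ^ 2 + ‖gradient u x‖ ^ 2 + ‖gradient v x‖ ^ 2) := by
  have hR0 : 0 ≤ R := (norm_nonneg _).trans hR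
  obtain ⟨-, -, hpβ, hqα, -, -⟩ := mul_le_sum_sq ‖u x‖ ‖v x‖ ‖gradient u x‖ ‖gradient v x‖
  set S := ‖u x‖ ^ 2 + ‖v x‖ ^ 2 + ‖gradient u x‖ ^ 2 + ‖gradient v x‖ ^ 2
  have hh : ‖‖x - a‖ ^ 2 / 2‖ ≤ R ^ 2 / 2 := by
    rw [Real.norm_of_nonneg (by positivity)]; gcongr
  refine (norm_sub_le _ _).trans ?_
  rw [norm_smul, norm_smul, norm_mul, norm_mul, mul_assoc, mul_assoc]
  calc _ ≤ R ^ 2 / 2 * S + R ^ 2 / 2 * S := by gcongr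
    _ = _ := by ring

lemma norm_radialCommutator_le (a : Space d) (u v : Space d → ℝ) {x : Space d} {R : ℝ}
    (hR : ‖x - a‖ ≤ R) : ‖radialCommutator a u v x‖ ≤ (2 * R) *
      (‖u x‖ ^ 2 + ‖v x‖ ^ 2 + ‖gradient u x‖ ^ 2 + ‖gradient v x‖ ^ 2) := by
  have hR0 : 0 ≤ R := (norm_nonneg _).trans hR
  obtain ⟨-, -, hpβ, hqα, -, -⟩ := mul_le_sum_sq ‖u x‖ ‖v x‖ ‖gradient u x‖ ‖gradient v x‖
  set S := ‖u x‖ ^ 2 + ‖v x‖ ^ 2 + ‖gradient u x‖ ^ 2 + ‖gradient v x‖ ^ 2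
  have hin : ∀ w : Space d, ‖(inner ℝ (x - a) w : ℝ)‖ ≤ R * ‖w‖ := fun w =>
    (norm_inner_le_norm _ _).trans (by gcongr)
  refine (norm_sub_le _ _).trans ?_
  rw [norm_mul, norm_mul]
  calc _ ≤ ‖v x‖ * (R * ‖gradient u x‖) + ‖u x‖ * (R * ‖gradient v x‖) := by
        gcongr <;> exact hin _
    _ = R * (‖v x‖ * ‖gradient u x‖) + R * (‖u x‖ * ‖gradient v x‖) := by ring
    _ ≤ R * S + R * S := by gcongr
    _ = _ := by ring

lemma contDiffOn_one (hu : IsEigenfunction Ω ΓD γ E u) : ContDiffOn ℝ 1 u Ω :=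
  hu.contDiffOn.of_le (by norm_num)

lemma contDiffOn_rellichField (hΩ : IsOpen Ω) (hu : IsEigenfunction Ω ΓD γ E u)
    (hv : IsEigenfunction Ω ΓD γ E' v) (a : Space d) (ℰ : ℝ) :
    ContDiffOn ℝ 1 (rellichField a u v ℰ) Ω := by
  have h1 := hu.contDiffOn_one
  have h2 := hv.contDiffOn_one
  have h3 := contDiffOn_gradient hΩ hu.contDiffOn
  have h4 := contDiffOn_gradient hΩ hv.contDiffOn
  have h5 : ContDiffOn ℝ 1 (fun x : Space d => x - a) Ω := contDiffOn_id.sub contDiffOn_const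
  exact ((((contDiffOn_const.mul h2).add (h5.inner ℝ h4)).smul h3).add
    (((contDiffOn_const.mul h1).add (h5.inner ℝ h3)).smul h4)).add
    (((contDiffOn_const.mul (h1.mul h2)).sub (h3.inner ℝ h4)).smul h5)

lemma contDiffOn_momentField (hΩ : IsOpen Ω) (hu : IsEigenfunction Ω ΓD γ E u)
    (hv : IsEigenfunction Ω ΓD γ E' v) (a : Space d) :
    ContDiffOn ℝ 1 (momentField a u v) Ω := by
  have h1 := hu.contDiffOn_one
  have h2 := hv.contDiffOn_one
  have h3 := contDiffOn_gradient hΩ hu.contDiffOn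
  have h4 := contDiffOn_gradient hΩ hv.contDiffOn
  have h5 : ContDiffOn ℝ 1 (fun x : Space d => ‖x - a‖ ^ 2 / 2) Ω :=
    ((contDiffOn_id.sub contDiffOn_const).norm_sq ℝ).div_const 2
  exact ((h5.mul h2).smul h3).sub ((h5.mul h1).smul h4)

lemma continuousOn_radialCommutator (hΩ : IsOpen Ω) (hu : IsEigenfunction Ω ΓD γ E u)
    (hv : IsEigenfunction Ω ΓD γ E' v) (a : Space d) :
    ContinuousOn (radialCommutator a u v) Ω := by
  have h1 := hu.contDiffOn_one.continuousOn
  have h2 := hv.contDiffOn_one.continuousOn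
  have h3 := (contDiffOn_gradient hΩ hu.contDiffOn).continuousOn
  have h4 := (contDiffOn_gradient hΩ hv.contDiffOn).continuousOn
  have h5 : ContinuousOn (fun x : Space d => x - a) Ω := by fun_prop
  exact (h2.mul (h5.inner h3)).sub (h1.mul (h5.inner h4))

lemma integrableOn_mul (hu : IsEigenfunction Ω ΓD γ E u) (hv : IsEigenfunction Ω ΓD γ E' v)
    (hΩ : IsLipschitzDomain Ω) (hd : 1 ≤ d) : IntegrableOn (fun x => u x * v x) Ω := by
  refine hΩ.integrableOn_of_maximalFunction hd
    (hu.contDiffOn_one.continuousOn.mul hv.contDiffOn_one.continuousOn) fun κ hκ =>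
    lintegral_maximalFunction_lt_top_of_le hu.regular hv.regular hu.regular_gradient
      hv.regular_gradient (C := 1) (fun x _ => ?_) hκ
  rw [one_mul, norm_mul]
  exact (mul_le_sum_sq _ _ _ _).1

lemma integrableOn_normSq_mul (hu : IsEigenfunction Ω ΓD γ E u)
    (hv : IsEigenfunction Ω ΓD γ E' v) (hΩ : IsLipschitzDomain Ω) (hd : 1 ≤ d) (a : Space d) {R : ℝ}
    (hR : ∀ x ∈ Ω, ‖x - a‖ ≤ R) : IntegrableOn (fun x => ‖x - a‖ ^ 2 * (u x * v x)) Ω := by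
  refine (hu.integrableOn_mul hv hΩ hd).bdd_mul (c := R ^ 2)
    (Continuous.aestronglyMeasurable (by fun_prop)) ?_
  filter_upwards [ae_restrict_mem hΩ.isOpen.measurableSet] with x hx
  rw [Real.norm_of_nonneg (by positivity)]
  gcongr
  exact hR x hx

lemma integrableOn_radialCommutator (hu : IsEigenfunction Ω ΓD γ E u)
    (hv : IsEigenfunction Ω ΓD γ E' v) (hΩ : IsLipschitzDomain Ω) (hd : 1 ≤ d) (a : Space d) {R : ℝ}
    (hR : ∀ x ∈ Ω, ‖x - a‖ ≤ R) : IntegrableOn (radialCommutator a u v) Ω :=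
  hΩ.integrableOn_of_maximalFunction hd (continuousOn_radialCommutator hΩ.isOpen hu hv a)
    fun _ hκ => lintegral_maximalFunction_lt_top_of_le hu.regular hv.regular hu.regular_gradient
      hv.regular_gradient (fun x hx => norm_radialCommutator_le a u v (hR x hx)) hκ

/-- The flux of the Rellich field through the boundary. -/
lemma flux_rellichField (hu : IsEigenfunction Ω ΓD γ E u) (hv : IsEigenfunction Ω ΓD γ E' v)
    (hΩ : IsLipschitzDomain Ω) (hd : 1 ≤ d) (a : Space d) {R : ℝ} (hR : ∀ x ∈ Ω, ‖x - a‖ ≤ R) :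
    Integrable (qIntegrand Ω a u v (E + E')) (surfaceMeasure Ω) ∧
      q Ω a u v (E + E') = (E + E') * (∫ x in Ω, u x * v x) +
        (E - E') / 2 * ∫ x in Ω, radialCommutator a u v x := by
  set B : Space d → Space d := fun s =>
    (((d : ℝ) - 2) / 2 * trace Ω v s + inner ℝ (s - a) (gradTrace Ω v s)) • gradTrace Ω u s +
    (((d : ℝ) - 2) / 2 * trace Ω u s + inner ℝ (s - a) (gradTrace Ω u s)) • gradTrace Ω v s +
    ((E + E') / 2 * (trace Ω u s * trace Ω v s) - inner ℝ (gradTrace Ω u s) (gradTrace Ω v s)) •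
      (s - a)
  have hB : ∀ᵐ s ∂(surfaceMeasure Ω), HasBoundaryValue Ω (rellichField a u v (E + E')) s (B s) := by
    filter_upwards [hu.ae_hasBoundaryValue, hv.ae_hasBoundaryValue] with s ⟨h1, h3⟩ ⟨h2, h4⟩
    intro κ hκ
    have h5 : Tendsto (fun x : Space d => x - a) (𝓝[approachRegion Ω κ s] s) (𝓝 (s - a)) :=
      (Continuous.tendsto (by fun_prop) s).mono_left nhdsWithin_le_nhds
    exact (((((h2 κ hκ).const_mul _).add (h5.inner (h4 κ hκ))).smul (h3 κ hκ)).add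
      ((((h1 κ hκ).const_mul _).add (h5.inner (h3 κ hκ))).smul (h4 κ hκ))).add
      (((((h1 κ hκ).mul (h2 κ hκ)).const_mul _).sub ((h3 κ hκ).inner (h4 κ hκ))).smul h5)
  have hdiv : EqOn (fun x => (E + E') * (u x * v x) + (E - E') / 2 * radialCommutator a u v x)
      (divergence (rellichField a u v (E + E'))) Ω :=
    fun x hx => (divergence_rellichField hΩ.isOpen hu hv a hx).symm
  have hi1 := (hu.integrableOn_mul hv hΩ hd).const_mul (E + E')
  have hi2 := (hu.integrableOn_radialCommutator hv hΩ hd a hR).const_mul ((E - E') / 2)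
  have hmain := hΩ.integral_divergence hd (contDiffOn_rellichField hΩ.isOpen hu hv a (E + E'))
    (fun κ hκ => lintegral_maximalFunction_lt_top_of_le hu.regular hv.regular hu.regular_gradient
      hv.regular_gradient (fun x hx => norm_rellichField_le a u v (E + E') (hR x hx)) hκ) hB
    (IntegrableOn.congr_fun (hi1.add hi2) hdiv hΩ.isOpen.measurableSet)
  have hq : (fun s => (inner ℝ (normal Ω s) (B s) : ℝ)) = qIntegrand Ω a u v (E + E') := by
    ext s
    simp only [B, qIntegrand, normalDeriv, radialDeriv, inner_add_right, inner_smul_right]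
    rw [real_inner_comm (s - a) (normal Ω s)]
    ring
  rw [hq] at hmain
  refine ⟨hmain.1, ?_⟩
  rw [q, ← hmain.2, ← setIntegral_congr_fun hΩ.isOpen.measurableSet hdiv, integral_add hi1 hi2,
    integral_const_mul, integral_const_mul]

/-- Green's second identity with weight ‖x - a‖²/2. The common boundary condition kills the flux,
which supplies the second factor `E - E'`. -/
lemma integral_radialCommutator (hu : IsEigenfunction Ω ΓD γ E u)
    (hv : IsEigenfunction Ω ΓD γ E' v) (hΩ : IsLipschitzDomain Ω) (hd : 1 ≤ d) (a : Space d) {R : ℝ}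
    (hR : ∀ x ∈ Ω, ‖x - a‖ ≤ R) :
    ∫ x in Ω, radialCommutator a u v x =
      (E - E') / 2 * ∫ x in Ω, ‖x - a‖ ^ 2 * (u x * v x) := by
  set B : Space d → Space d := fun s =>
    (‖s - a‖ ^ 2 / 2 * trace Ω v s) • gradTrace Ω u s -
      (‖s - a‖ ^ 2 / 2 * trace Ω u s) • gradTrace Ω v s
  have hB : ∀ᵐ s ∂(surfaceMeasure Ω), HasBoundaryValue Ω (momentField a u v) s (B s) := by
    filter_upwards [hu.ae_hasBoundaryValue, hv.ae_hasBoundaryValue] with s ⟨h1, h3⟩ ⟨h2, h4⟩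
    intro κ hκ
    have h5 : Tendsto (fun x : Space d => ‖x - a‖ ^ 2 / 2) (𝓝[approachRegion Ω κ s] s)
        (𝓝 (‖s - a‖ ^ 2 / 2)) :=
      (Continuous.tendsto (by fun_prop) s).mono_left nhdsWithin_le_nhds
    exact ((h5.mul (h2 κ hκ)).smul (h3 κ hκ)).sub ((h5.mul (h1 κ hκ)).smul (h4 κ hκ))
  have hdiv : EqOn (fun x => radialCommutator a u v x - (E - E') / 2 * (‖x - a‖ ^ 2 * (u x * v x)))
      (divergence (momentField a u v)) Ω :=
    fun x hx => (divergence_momentField hΩ.isOpen hu hv a hx).symm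
  have hi1 := (hu.integrableOn_normSq_mul hv hΩ hd a hR).const_mul ((E - E') / 2)
  have hi2 := hu.integrableOn_radialCommutator hv hΩ hd a hR
  have hmain := hΩ.integral_divergence hd (contDiffOn_momentField hΩ.isOpen hu hv a)
    (fun κ hκ => lintegral_maximalFunction_lt_top_of_le hu.regular hv.regular hu.regular_gradient
      hv.regular_gradient (fun x hx => norm_momentField_le a u v (hR x hx)) hκ) hB
    (IntegrableOn.congr_fun (hi2.sub hi1) hdiv hΩ.isOpen.measurableSet)
  have hzero : (fun s => (inner ℝ (normal Ω s) (B s) : ℝ)) =ᵐ[surfaceMeasure Ω] fun _ => 0 := by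
    filter_upwards [hu.dirichlet, hv.dirichlet, hu.robin, hv.robin] with s h1 h2 h3 h4
    have h5 : inner ℝ (normal Ω s) (B s) = ‖s - a‖ ^ 2 / 2 *
        (trace Ω v s * normalDeriv Ω u s - trace Ω u s * normalDeriv Ω v s) := by
      simp only [B, normalDeriv, inner_sub_right, inner_smul_right]
      ring
    rw [h5]
    by_cases hs : s ∈ ΓD
    · rw [h1 hs, h2 hs]; ring
    -- Off `ΓD`, cross-multiplying the two Robin conditions by the traces eliminates `γ`.
    · linear_combination ‖s - a‖ ^ 2 / 2 * (trace Ω v s * h3 hs - trace Ω u s * h4 hs)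
  rw [integral_congr_ae hzero, integral_zero,
    ← setIntegral_congr_fun hΩ.isOpen.measurableSet hdiv, integral_sub hi2 hi1,
    integral_const_mul] at hmain
  linarith [hmain.2]

/-- The boundary form of two eigenfunctions in terms of interior integrals. -/
theorem q_eq (hu : IsEigenfunction Ω ΓD γ E u) (hv : IsEigenfunction Ω ΓD γ E' v)
    (hΩ : IsLipschitzDomain Ω) (hd : 1 ≤ d) (a : Space d) {R : ℝ} (hR : ∀ x ∈ Ω, ‖x - a‖ ≤ R) :
    q Ω a u v (E + E') = (E + E') * (∫ x in Ω, u x * v x) +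
      (E - E') ^ 2 / 4 * ∫ x in Ω, ‖x - a‖ ^ 2 * (u x * v x) := by
  rw [(hu.flux_rellichField hv hΩ hd a hR).2, hu.integral_radialCommutator hv hΩ hd a hR]
  ring

/-- Pointwise, the integrand is at most R²(u² + v²)/2, and both normalizations equal 1. -/
lemma abs_integral_normSq_mul_le (hu : IsEigenfunction Ω ΓD γ E u)
    (hv : IsEigenfunction Ω ΓD γ E' v) (hΩ : IsLipschitzDomain Ω) (hd : 1 ≤ d) (a : Space d) {R : ℝ}
    (hR : ∀ x ∈ Ω, ‖x - a‖ ≤ R) (hu1 : ∫ x in Ω, u x * u x = 1) (hv1 : ∫ x in Ω, v x * v x = 1) :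
    |∫ x in Ω, ‖x - a‖ ^ 2 * (u x * v x)| ≤ R ^ 2 := by
  have hi := ((hu.integrableOn_mul hu hΩ hd).add (hv.integrableOn_mul hv hΩ hd)).const_mul (R ^ 2 / 2)
  calc |∫ x in Ω, ‖x - a‖ ^ 2 * (u x * v x)|
      ≤ ∫ x in Ω, R ^ 2 / 2 * (u x * u x + v x * v x) := by
        rw [← Real.norm_eq_abs]
        refine norm_integral_le_of_norm_le hi ?_
        filter_upwards [ae_restrict_mem hΩ.isOpen.measurableSet] with x hx
        have h1 : ‖x - a‖ ^ 2 ≤ R ^ 2 := by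
          gcongr
          exact hR x hx
        have h2 : |u x * v x| ≤ (u x * u x + v x * v x) / 2 := by
          rw [abs_le]
          constructor <;> nlinarith [sq_nonneg (u x - v x), sq_nonneg (u x + v x)]
        rw [norm_mul, Real.norm_of_nonneg (by positivity), Real.norm_eq_abs]
        calc _ ≤ R ^ 2 * ((u x * u x + v x * v x) / 2) := by gcongr
          _ = _ := by ring
    _ = R ^ 2 := by
        rw [integral_const_mul, integral_add (hu.integrableOn_mul hu hΩ hd)
          (hv.integrableOn_mul hv hΩ hd), hu1, hv1]
        ring

end IsEigenfunction

end QuadraticIdentity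

/-! ### The smallest enclosing ball and the optimal origin. -/

section EnclosingBall

variable {d : ℕ} {Ω : Set (Space d)}

/-- A point of the closure of a bounded open set at maximal distance from `a` is on the boundary. -/
lemma exists_isMaxOn_frontier (hd : 1 ≤ d) (hΩ : IsOpen Ω) (hb : Bornology.IsBounded Ω)
    (hne : Ω.Nonempty) (a : Space d) :
    ∃ z ∈ frontier Ω, ∀ x ∈ closure Ω, ‖x - a‖ ≤ ‖z - a‖ := by
  have : Nontrivial (Space d) := by
    have : NeZero d := ⟨by omega⟩
    infer_instance
  obtain ⟨z, hz, hmax⟩ := hb.isCompact_closure.exists_isMaxOn hne.closure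
    (f := fun x => ‖x - a‖) (by fun_prop)
  refine ⟨z, ?_, fun x hx => hmax hx⟩
  rw [hΩ.frontier_eq]
  refine ⟨hz, fun hzΩ => ?_⟩
  -- An interior maximizer could be pushed farther from `a` along `z - a`, or along any nonzero
  -- direction when `z = a`.
  obtain ⟨w, hw, hwz⟩ : ∃ w : Space d, w ≠ 0 ∧ ∀ t : ℝ, 0 < t → ‖z - a‖ < ‖z - a + t • w‖ := by
    by_cases hza : z - a = 0
    · obtain ⟨w, hw⟩ := exists_ne (0 : Space d)
      refine ⟨w, hw, fun t ht => ?_⟩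
      rw [hza, zero_add, norm_zero]
      exact norm_pos_iff.2 (smul_ne_zero ht.ne' hw)
    · refine ⟨z - a, hza, fun t ht => ?_⟩
      have h1 : z - a + t • (z - a) = (1 + t) • (z - a) := by module
      have h2 : 0 < ‖z - a‖ := norm_pos_iff.2 hza
      rw [h1, norm_smul, Real.norm_of_nonneg (by positivity)]
      nlinarith
  have hl : Tendsto (fun t : ℝ => z + t • w) (𝓝[>] 0) (𝓝 z) := by
    have : Tendsto (fun t : ℝ => z + t • w) (𝓝 0) (𝓝 (z + (0 : ℝ) • w)) :=
      Continuous.tendsto (by fun_prop) 0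
    rw [zero_smul, add_zero] at this
    exact this.mono_left nhdsWithin_le_nhds
  obtain ⟨t, htΩ, ht⟩ := ((hl.eventually (hΩ.eventually_mem hzΩ)).and self_mem_nhdsWithin).exists
  have h1 : ‖z + t • w - a‖ ≤ ‖z - a‖ := hmax (subset_closure htΩ)
  have h2 := hwz t ht
  rw [show z - a + t • w = z + t • w - a by abel] at h2
  exact absurd h1 h2.not_ge

lemma isGreatest_maxRadius (hd : 1 ≤ d) (hΩ : IsOpen Ω) (hb : Bornology.IsBounded Ω)
    (hne : Ω.Nonempty) (a : Space d) :
    IsGreatest ((fun s => ‖s - a‖) '' frontier Ω) (maxRadius Ω a) := by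
  obtain ⟨z, hz, hmax⟩ := exists_isMaxOn_frontier hd hΩ hb hne a
  have h : IsGreatest ((fun s => ‖s - a‖) '' frontier Ω) ‖z - a‖ := by
    refine ⟨⟨z, hz, rfl⟩, ?_⟩
    rintro _ ⟨x, hx, rfl⟩
    exact hmax x (frontier_subset_closure hx)
  rw [maxRadius, h.csSup_eq]
  exact h

lemma norm_sub_le_maxRadius (hd : 1 ≤ d) (hΩ : IsOpen Ω) (hb : Bornology.IsBounded Ω)
    (hne : Ω.Nonempty) (a : Space d) {x : Space d} (hx : x ∈ Ω) : ‖x - a‖ ≤ maxRadius Ω a := by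
  obtain ⟨z, hz, hmax⟩ := exists_isMaxOn_frontier hd hΩ hb hne a
  exact (hmax x (subset_closure hx)).trans
    ((isGreatest_maxRadius hd hΩ hb hne a).2 ⟨z, hz, rfl⟩)

/-- Turns the search for the smallest enclosing ball into the minimization of `maxRadius Ω`. -/
lemma subset_closedBall_iff_maxRadius_le (hd : 1 ≤ d) (hΩ : IsOpen Ω) (hb : Bornology.IsBounded Ω)
    (hne : Ω.Nonempty) (a : Space d) (ρ : ℝ) :
    Ω ⊆ Metric.closedBall a ρ ↔ maxRadius Ω a ≤ ρ := by
  constructor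
  · intro h
    obtain ⟨s, hs, hsa⟩ := (isGreatest_maxRadius hd hΩ hb hne a).1
    rw [← hsa]
    have := closure_minimal h Metric.isClosed_closedBall (frontier_subset_closure hs)
    rwa [Metric.mem_closedBall, dist_eq_norm] at this
  · intro h x hx
    rw [Metric.mem_closedBall, dist_eq_norm]
    exact (norm_sub_le_maxRadius hd hΩ hb hne a hx).trans h

lemma maxRadius_nonneg (hd : 1 ≤ d) (hΩ : IsOpen Ω) (hb : Bornology.IsBounded Ω)
    (hne : Ω.Nonempty) (a : Space d) : 0 ≤ maxRadius Ω a := by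
  obtain ⟨x, hx⟩ := hne
  exact (norm_nonneg _).trans (norm_sub_le_maxRadius hd hΩ hb ⟨x, hx⟩ a hx)

/-- The radius is 1-Lipschitz in the centre and tends to infinity with it, so a minimum is attained.
-/
lemma exists_forall_maxRadius_le (hd : 1 ≤ d) (hΩ : IsOpen Ω) (hb : Bornology.IsBounded Ω)
    (hne : Ω.Nonempty) : ∃ a₀, ∀ a, maxRadius Ω a₀ ≤ maxRadius Ω a := by
  have hlip : ∀ a b, maxRadius Ω a ≤ maxRadius Ω b + dist a b := by
    intro a b
    rw [← subset_closedBall_iff_maxRadius_le hd hΩ hb hne]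
    exact ((subset_closedBall_iff_maxRadius_le hd hΩ hb hne b _).2 le_rfl).trans
      (Metric.closedBall_subset_closedBall' (by rw [dist_comm]))
  have hc : Continuous (maxRadius Ω) :=
    (LipschitzWith.of_le_add hlip).continuous
  obtain ⟨x, hx⟩ := hne
  refine hc.exists_forall_le (tendsto_atTop_mono (f := fun a => ‖x - a‖)
    (fun a => norm_sub_le_maxRadius hd hΩ hb ⟨x, hx⟩ a hx) ?_)
  refine tendsto_atTop_mono (f := fun a => ‖a‖ - ‖x‖) (fun a => ?_)
    (tendsto_atTop_add_const_right _ _ tendsto_norm_cocompact_atTop)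
  rw [norm_sub_rev]
  exact norm_sub_norm_le _ _

/-- If two distinct centres shared the minimal radius, the parallelogram law would give their
midpoint a strictly smaller one. -/
lemma eq_of_maxRadius_le (hd : 1 ≤ d) (hΩ : IsOpen Ω) (hb : Bornology.IsBounded Ω)
    (hne : Ω.Nonempty) {a b : Space d} {ρ : ℝ} (hρ : ∀ c, ρ ≤ maxRadius Ω c)
    (ha : maxRadius Ω a ≤ ρ) (hb' : maxRadius Ω b ≤ ρ) : a = b := by
  by_contra hab
  set m : Space d := (1 / 2 : ℝ) • (a + b) with hm
  obtain ⟨s, hs, hsm⟩ := (isGreatest_maxRadius hd hΩ hb hne m).1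
  have h1 : ‖s - a‖ ≤ ρ := ((isGreatest_maxRadius hd hΩ hb hne a).2 ⟨s, hs, rfl⟩).trans ha
  have h2 : ‖s - b‖ ≤ ρ := ((isGreatest_maxRadius hd hΩ hb hne b).2 ⟨s, hs, rfl⟩).trans hb'
  have h3 : ρ ≤ ‖s - m‖ := (hρ m).trans_eq hsm.symm
  have h4 := parallelogram_law_with_norm ℝ (s - a) (s - b)
  have h5 : s - a + (s - b) = (2 : ℝ) • (s - m) := by rw [hm]; module
  have h6 : s - a - (s - b) = b - a := by abel
  rw [h5, h6, norm_smul, Real.norm_of_nonneg zero_le_two] at h4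
  have h7 : 0 < ‖b - a‖ := norm_pos_iff.2 (sub_ne_zero.2 (Ne.symm hab))
  have h8 : 0 ≤ ρ := (norm_nonneg _).trans h1
  nlinarith [norm_nonneg (s - a), norm_nonneg (s - b), mul_self_le_mul_self (norm_nonneg _) h1,
    mul_self_le_mul_self (norm_nonneg _) h2, mul_self_le_mul_self h8 h3, mul_pos h7 h7]

end EnclosingBall

end QuasiOrth

/-! ### The main theorem. -/

theorem theorem1 {d : ℕ} (hd : 2 ≤ d)
    (Ω : Set (QuasiOrth.Space d)) (hΩ : QuasiOrth.IsLipschitzDomain Ω) (hne : Ω.Nonempty)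
    (ΓD : Set (QuasiOrth.Space d)) (hΓD : IsCompact ΓD) (hΓDsub : ΓD ⊆ frontier Ω)
    (γ : QuasiOrth.Space d → ℝ) (hγ : ∃ M : ℝ, ∀ s ∈ frontier Ω \ ΓD, |γ s| ≤ M)
    {ι : Type*} (φ : ι → QuasiOrth.Space d → ℝ) (E : ι → ℝ)
    (hφ : ∀ i, QuasiOrth.IsEigenfunction Ω ΓD γ (E i) (φ i))
    (hnorm : ∀ i, ∫ x in Ω, φ i x * φ i x = 1)
    (horth : ∀ i j, i ≠ j → ∫ x in Ω, φ i x * φ j x = 0) :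
    -- for every position `a` of the origin: convergence, diagonal, off-diagonal with `C = R²/4`
    (∀ a : QuasiOrth.Space d,
      (∀ i j, Integrable (QuasiOrth.qIntegrand Ω a (φ i) (φ j) (E i + E j))
        (QuasiOrth.surfaceMeasure Ω)) ∧
      (∀ i, QuasiOrth.Q Ω a φ E i i = 2 * E i) ∧
      IsGreatest ((fun s => ‖s - a‖) '' frontier Ω) (QuasiOrth.maxRadius Ω a) ∧
      (∀ i j, i ≠ j →
        |QuasiOrth.Q Ω a φ E i j| ≤ QuasiOrth.maxRadius Ω a ^ 2 / 4 * (E i - E j) ^ 2)) ∧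
    -- the smallest enclosing ball has a unique centre, which is the optimal origin, and the
    -- constant there is `C₀ = R₀²/4`
    (∃ (a₀ : QuasiOrth.Space d) (R₀ : ℝ),
      IsLeast {ρ : ℝ | ∃ a, Ω ⊆ Metric.closedBall a ρ} R₀ ∧
      (∀ a, Ω ⊆ Metric.closedBall a R₀ ↔ a = a₀) ∧
      QuasiOrth.maxRadius Ω a₀ = R₀ ∧
      (∀ a, a ≠ a₀ → R₀ ^ 2 / 4 < QuasiOrth.maxRadius Ω a ^ 2 / 4) ∧
      (∀ i j, i ≠ j → |QuasiOrth.Q Ω a₀ φ E i j| ≤ R₀ ^ 2 / 4 * (E i - E j) ^ 2)) := by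
  have hd1 : 1 ≤ d := by omega
  have hR : ∀ a, ∀ x ∈ Ω, ‖x - a‖ ≤ QuasiOrth.maxRadius Ω a := fun a x hx =>
    QuasiOrth.norm_sub_le_maxRadius hd1 hΩ.isOpen hΩ.isBounded hne a hx
  have hoff : ∀ a, ∀ i j, i ≠ j →
      |QuasiOrth.Q Ω a φ E i j| ≤ QuasiOrth.maxRadius Ω a ^ 2 / 4 * (E i - E j) ^ 2 := by
    intro a i j hij
    have h1 := (hφ i).abs_integral_normSq_mul_le (hφ j) hΩ hd1 a (hR a) (hnorm i) (hnorm j)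
    rw [QuasiOrth.Q, (hφ i).q_eq (hφ j) hΩ hd1 a (hR a), horth i j hij, mul_zero, zero_add, abs_mul,
      abs_of_nonneg (by positivity)]
    calc _ ≤ (E i - E j) ^ 2 / 4 * QuasiOrth.maxRadius Ω a ^ 2 := by gcongr
      _ = _ := by ring
  refine ⟨fun a => ⟨fun i j => ((hφ i).flux_rellichField (hφ j) hΩ hd1 a (hR a)).1, fun i => ?_,
    QuasiOrth.isGreatest_maxRadius hd1 hΩ.isOpen hΩ.isBounded hne a, hoff a⟩, ?_⟩
  · rw [QuasiOrth.Q, (hφ i).q_eq (hφ i) hΩ hd1 a (hR a), hnorm i]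
    ring
  obtain ⟨a₀, ha₀⟩ := QuasiOrth.exists_forall_maxRadius_le hd1 hΩ.isOpen hΩ.isBounded hne
  have hiff := QuasiOrth.subset_closedBall_iff_maxRadius_le hd1 hΩ.isOpen hΩ.isBounded hne
  have huniq : ∀ a, QuasiOrth.maxRadius Ω a ≤ QuasiOrth.maxRadius Ω a₀ → a = a₀ := fun a ha =>
    QuasiOrth.eq_of_maxRadius_le hd1 hΩ.isOpen hΩ.isBounded hne ha₀ ha le_rfl
  refine ⟨a₀, QuasiOrth.maxRadius Ω a₀, ⟨⟨a₀, (hiff _ _).2 le_rfl⟩, ?_⟩, fun a => ?_, rfl,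
    fun a ha => ?_, hoff a₀⟩
  · rintro ρ ⟨a, ha⟩
    exact (ha₀ a).trans ((hiff _ _).1 ha)
  · rw [hiff]
    exact ⟨huniq a, fun h => h ▸ le_rfl⟩
  · have h1 : QuasiOrth.maxRadius Ω a₀ < QuasiOrth.maxRadius Ω a :=
      not_le.1 fun h => ha (huniq a h)
    have h2 := QuasiOrth.maxRadius_nonneg hd1 hΩ.isOpen hΩ.isBounded hne a₀
    gcongr
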